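/- Let $\mathbb{K}=\mathbb{R}$ (Riemannian case) or $\mathbb{K}=\mathbb{C}$ (complexified case), let $U\subset\mathbb{K}^4$ be open and connected, let $\eta=\sum_a (dx^a)^2$, and let $\Omega_+$ be a smooth (for $\mathbb{K}=\mathbb{C}$: holomorphic) $\mathbb{K}$-valued function on $U$. Call a pair $(\hat g,\hat\kappa)$ with $\hat g=\Omega_+^2\eta$, $\Omega_+$ nowhere zero and $\hat\kappa$ a self-dual 2-form, a conformally flat Kähler structure on $U$ if there is a $\hat g$-compatible integrable complex structure $J$, $J^2=-1$, with $\hat\kappa_{ab}=\hat g_{bc}J^c{}_a$ and $d\hat\kappa=0$. Regard $\mathbb{K}^4$ as a subset of $\mathbb{C}^4$; put $t=x^0$, $x=-ix^1$, $y=-ix^2$, $z=-ix^3$, so that $\eta=dt^2-dx^2-dy^2-dz^2$, and $x^{00'}=\frac{t+z}{\sqrt2}$, $x^{11'}=\frac{t-z}{\sqrt2}$, $x^{01'}=\frac{x+iy}{\sqrt2}$, $x^{10'}=\frac{x-iy}{\sqrt2}$. Spinor indices are moved with $\epsilon_{AB},\epsilon_{A'B'}$ ($\epsilon_{01}=\epsilon^{01}=1$,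 $\xi^A=\epsilon^{AB}\xi_B$, $\xi_B=\xi^A\epsilon_{AB}$). A twistor quadric is given by $\chi(Z)=Q_{\alpha\beta}Z^\alpha Z^\beta$, $Z^\alpha=(\omega^A,\pi_{A'})\in\mathbb{C}^4$, with $Q$ symmetric and not of the form $A_\alpha A_\beta$; its restriction to the twistor line $L_x\cong\mathbb{CP}^1$ is obtained by putting $\omega^A=ix^{AA'}\pi_{A'}$. For an integer $h\ge0$ put $$\phi_{A_1'\dots A_{2h}'}(x)=\frac1{2\pi i}\oint_\Gamma \chi^{-(h+1)}\big|_{L_x}\,\pi_{A_1'}\cdots\pi_{A_{2h}'}\,\pi_{B'}d\pi^{B'},$$ where $\Gamma$ is a closed contour, fixed near each point of $U$, that separates the two zeros of $\chi|_{L_x}$ (winding once, in either orientation). Say that $\chi$ generates $\Omega_+$ if $\Omega_+=\phi$ ($h=0$) and that it generates $\hat\kappa$ if $\hat\kappa_{ab}=-i\,\phi_{A'B'}\epsilon_{AB}$ ($h=1$). (1) For every conformally flat Kähler structure $(\Omega_+^2\eta,\hat\kappa)$ on $U$ there is a twistor quadric $\chi$ that generates both $\Omega_+$ and $\hat\kappa$,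 with the same contours. Moreover, writing $2i\chi=a_{AB}\omega^A\omega^B+2b_A^{B'}\omega^A\pi_{B'}+c^{A'B'}\pi_{A'}\pi_{B'}$ with $a,c$ symmetric, one has on $U$ $$2\,\Omega_+^{-2}=\tfrac14a_{AB}a^{AB}(x_ax^a)^2+2i\,a_{AB}b^B_{A'}x^{AA'}x_cx^c-2a_{AB}c_{A'B'}x^{AA'}x^{BB'}-2[(b_ab^a)(x_bx^b)-(b_ax^a)^2]+4i\,b_A^{B'}c_{A'B'}x^{AA'}+c^{A'B'}c_{A'B'}.\qquad(*)$$ (2) Let $(\Omega_+^2\eta,\hat\kappa)$ be a conformally flat Kähler structure on $U$ and let $\chi$ be any twistor quadric that generates $\Omega_+$. If the 2-form $\hat\kappa'=-i\,\phi_{A'B'}\epsilon_{AB}$ ($h=1$, same contours) is $\mathbb{K}$-valued (which is automatic for $\mathbb{K}=\mathbb{C}$), then $(\Omega_+^2\eta,\hat\kappa')$ is a conformally flat Kähler structure on $U$. If moreover the metric $\Omega_+^2\eta$ is not flat on $U$, then $\hat\kappa'=\hat\kappa$ or $\hat\kappa'=-\hat\kappa$ on $U$ (here the $\mathbb{K}$-valuedness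 is not assumed). (3) Conversely, if $\Omega_+$ is smooth and nowhere zero on $U$ and satisfies $(*)$ for some constant spinors $a_{AB}=a_{(AB)}$, $b_A^{B'}$, $c^{A'B'}=c^{(A'B')}$, then the $\chi$ with $2i\chi=a_{AB}\omega^A\omega^B+2b_A^{B'}\omega^A\pi_{B'}+c^{A'B'}\pi_{A'}\pi_{B'}$ generates $\Omega_+$ for a suitable choice of contours, and, if the form $\hat\kappa'=-i\,\phi_{A'B'}\epsilon_{AB}$ ($h=1$, same contours) is $\mathbb{K}$-valued, $(\Omega_+^2\eta,\hat\kappa')$ is a conformally flat Kähler structure on $U$. -/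

import Mathlib

open scoped ContDiff Topology

noncomputable section

namespace TwistorQuadric

/-! ## Tensor calculus on open subsets of `𝕜⁴`

`𝕜 = ℝ` gives smooth Riemannian structures, `𝕜 = ℂ` gives complexified (holomorphic) ones. -/

section Tensors

variable {𝕜 : Type*} [RCLike 𝕜]

/-- Points of `𝕜⁴`, with coordinates `(x⁰, x¹, x², x³)`. -/
abbrev Pt (𝕜 : Type*) : Type _ := Fin 4 → 𝕜

/-- The partial derivative `∂_a f`. -/
def pd (f : Pt 𝕜 → 𝕜) (a : Fin 4) (x : Pt 𝕜) : 𝕜 :=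
  fderiv 𝕜 f x (Pi.single a 1)

/-- A tensor field with two indices is smooth on `U` (for `𝕜 = ℂ`: holomorphic). -/
def SmoothTensorOn (T : Pt 𝕜 → Matrix (Fin 4) (Fin 4) 𝕜) (U : Set (Pt 𝕜)) : Prop :=
  ∀ a b, ContDiffOn 𝕜 ∞ (fun x => T x a b) U

/-- Christoffel symbols `Γ^c_{ab}` of a metric `g`. -/
def christoffel (g : Pt 𝕜 → Matrix (Fin 4) (Fin 4) 𝕜) (c a b : Fin 4) (x : Pt 𝕜) : 𝕜 :=
  (1 / 2) * ∑ d, (g x)⁻¹ c d *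
    (pd (fun y => g y d b) a x + pd (fun y => g y d a) b x - pd (fun y => g y a b) d x)

/-- Riemann tensor `R^d_{cab}` of a metric `g`. -/
def riemann (g : Pt 𝕜 → Matrix (Fin 4) (Fin 4) 𝕜) (d c a b : Fin 4) (x : Pt 𝕜) : 𝕜 :=
  pd (christoffel g d b c) a x - pd (christoffel g d a c) b x
    + ∑ e, (christoffel g d a e x * christoffel g e b c x
      - christoffel g d b e x * christoffel g e a c x)

/-- The metric `g` is flat on `U`. -/
def IsFlatOn (g : Pt 𝕜 → Matrix (Fin 4) (Fin 4) 𝕜) (U : Set (Pt 𝕜)) : Prop :=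
  ∀ x ∈ U, ∀ d c a b, riemann g d c a b x = 0

/-- The Nijenhuis tensor `N^c_{ab}` of `J`, with `J x c a = J^c_a`. -/
def nijenhuis (J : Pt 𝕜 → Matrix (Fin 4) (Fin 4) 𝕜) (c a b : Fin 4) (x : Pt 𝕜) : 𝕜 :=
  ∑ d, (J x d a * pd (fun y => J y c b) d x - J x d b * pd (fun y => J y c a) d x
    - J x c d * (pd (fun y => J y d b) a x - pd (fun y => J y d a) b x))

/-- `(g, κ)` is a Kähler structure on `U`: `g` is a metric, there is an integrable complex
structure `J` on `U` compatible with `g`, the fundamental form is `κ_{ab} = g_{bc} J^c_a`, and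
`dκ = 0`. -/
def IsKahler (U : Set (Pt 𝕜)) (g κ : Pt 𝕜 → Matrix (Fin 4) (Fin 4) 𝕜) : Prop :=
  SmoothTensorOn g U ∧ (∀ x ∈ U, (g x).IsSymm ∧ (g x).det ≠ 0) ∧
  ∃ J : Pt 𝕜 → Matrix (Fin 4) (Fin 4) 𝕜,
    SmoothTensorOn J U ∧
    (∀ x ∈ U, J x * J x = -1) ∧
    (∀ x ∈ U, (J x).transpose * g x * J x = g x) ∧
    (∀ x ∈ U, ∀ c a b, nijenhuis J c a b x = 0) ∧
    (∀ x ∈ U, ∀ a b, κ x a b = ∑ c, g x b c * J x c a) ∧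
    (∀ x ∈ U, ∀ a b c, pd (fun y => κ y b c) a x + pd (fun y => κ y c a) b x
      + pd (fun y => κ y a b) c x = 0)

/-- The Levi-Civita symbol `ε_{abcd}` with `ε_{0123} = 1`. -/
def leviCivita (a b c d : Fin 4) : 𝕜 :=
  (Matrix.of fun i j : Fin 4 => if ![a, b, c, d] i = j then (1 : 𝕜) else 0).det

/-- `κ` is self-dual: `½ ε_{ab}^{cd} κ_{cd} = κ_{ab}`. In dimension four the Hodge star on 2-forms
is conformally invariant, so for the metrics `Ω² δ` considered here it is that of `δ`. -/
def IsSelfDualOn (U : Set (Pt 𝕜)) (κ : Pt 𝕜 → Matrix (Fin 4) (Fin 4) 𝕜) : Prop :=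
  ∀ x ∈ U, ∀ a b, (1 / 2) * ∑ c, ∑ d, leviCivita a b c d * κ x c d = κ x a b

/-- The metric `ĝ = Ω² η`, where `η = δ_{ab} dx^a dx^b` is the flat metric. -/
def conformalMetric (Ω : Pt 𝕜 → 𝕜) (x : Pt 𝕜) : Matrix (Fin 4) (Fin 4) 𝕜 :=
  (Ω x) ^ 2 • (1 : Matrix (Fin 4) (Fin 4) 𝕜)

/-- `(Ω² η, κ)` is a conformally flat Kähler structure on `U` with self-dual orientation. -/
structure IsConformallyFlatKahler (U : Set (Pt 𝕜)) (Ω : Pt 𝕜 → 𝕜)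
    (κ : Pt 𝕜 → Matrix (Fin 4) (Fin 4) 𝕜) : Prop where
  smooth : ContDiffOn 𝕜 ∞ Ω U
  ne_zero : ∀ x ∈ U, Ω x ≠ 0
  kahler : IsKahler U (conformalMetric Ω) κ
  selfDual : IsSelfDualOn U κ

end Tensors

/-! ## Spinors and twistors of complexified flat space -/

/-- The spinor form `x^{AA'}` (row `A`, column `A'`) of a point or vector of `ℂ⁴`. In terms of
`t = x⁰, x = -i x¹, y = -i x², z = -i x³` these are `x^{00'} = (t+z)/√2`, `x^{11'} = (t-z)/√2`,
`x^{01'} = (x+iy)/√2`, `x^{10'} = (x-iy)/√2`, and `dt² - dx² - dy² - dz² = δ_{ab} dx^a dx^b`. -/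
def spinorForm (x : Pt ℂ) : Matrix (Fin 2) (Fin 2) ℂ :=
  ((Real.sqrt 2 : ℝ) : ℂ)⁻¹ •
    !![x 0 + (-Complex.I * x 3), (-Complex.I * x 1) + Complex.I * (-Complex.I * x 2);
       (-Complex.I * x 1) - Complex.I * (-Complex.I * x 2), x 0 - (-Complex.I * x 3)]

/-- `ε_{AB} = ε^{AB}`, and the same for primed indices. Indices are moved by
`ξ^A = ε^{AB} ξ_B` and `ξ_B = ξ^A ε_{AB}`. -/
def eps : Matrix (Fin 2) (Fin 2) ℂ := !![0, 1; -1, 0]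

/-- `M_{AB} ↦ M^{AB}`. -/
def raise₂ (M : Matrix (Fin 2) (Fin 2) ℂ) : Matrix (Fin 2) (Fin 2) ℂ :=
  Matrix.of fun A B => ∑ C, ∑ D, eps A C * eps B D * M C D

/-- `M^{AB} ↦ M_{AB}`. -/
def lower₂ (M : Matrix (Fin 2) (Fin 2) ℂ) : Matrix (Fin 2) (Fin 2) ℂ :=
  Matrix.of fun A B => ∑ C, ∑ D, M C D * eps C A * eps D B

/-- `M^{..}_A{}^{B} ↦ M^{A B}`: raise the first index. -/
def raiseFst (M : Matrix (Fin 2) (Fin 2) ℂ) : Matrix (Fin 2) (Fin 2) ℂ :=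
  Matrix.of fun A B => ∑ C, eps A C * M C B

/-- `M_A{}^{B} ↦ M_{A B}`: lower the second index. -/
def lowerSnd (M : Matrix (Fin 2) (Fin 2) ℂ) : Matrix (Fin 2) (Fin 2) ℂ :=
  Matrix.of fun A B => ∑ C, M A C * eps C B

/-- Full contraction of two spinors with two indices each, one with lower, one with upper
indices. -/
def contract (M N : Matrix (Fin 2) (Fin 2) ℂ) : ℂ := ∑ A, ∑ B, M A B * N A B

/-- Twistor index: `Sum.inl A` for `ω^A`, `Sum.inr A'` for `π_{A'}`. -/
abbrev TIdx : Type := Fin 2 ⊕ Fin 2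

/-- The twistor `Z^α = (i x^{AA'} π_{A'}, π_{A'})` on the twistor line of `x` (incidence
relation). -/
def twistorOn (x : Pt ℂ) (p : Fin 2 → ℂ) : TIdx → ℂ :=
  Sum.elim (fun A => Complex.I * ∑ A', spinorForm x A A' * p A') p

/-- `χ(Z) = Q_{αβ} Z^α Z^β`. -/
def chi (Q : Matrix TIdx TIdx ℂ) (Z : TIdx → ℂ) : ℂ := ∑ α, ∑ β, Q α β * Z α * Z β

/-- The matrix of a twistor quadric: symmetric and not of the form `A_α A_β`. -/
def IsTwistorQuadric (Q : Matrix TIdx TIdx ℂ) : Prop :=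
  Q.IsSymm ∧ ¬ ∃ A : TIdx → ℂ, ∀ α β, Q α β = A α * A β

/-- The restriction of `χ` to the twistor line of `x`, in homogeneous coordinates. -/
def chiOnLine (Q : Matrix TIdx TIdx ℂ) (x : Pt ℂ) (p : Fin 2 → ℂ) : ℂ := chi Q (twistorOn x p)

/-- `γ : [0,1] → ℂ² ∖ 0` represents (in homogeneous coordinates) a closed `C¹` contour in `ℂℙ¹`
that separates the two zeros of the quadratic form `q`: it misses the zeros, and it winds exactly
once around one of them relative to the other. That is, for a factorization of `q` into linear
forms `α, β` (so the zeros of `q` are those of `α` and of `β`) the loop `α(γ)/β(γ)` in `ℂ ∖ 0` has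
winding number one. Exchanging `α` and `β` reverses the orientation, so both orientations of
the contour are allowed; `q` has a separating contour only if its two zeros are distinct. -/
structure IsSeparatingContour (q : (Fin 2 → ℂ) → ℂ) (γ : ℝ → Fin 2 → ℂ) : Prop where
  contDiff : ContDiffOn ℝ 1 γ (Set.Icc 0 1)
  closed : γ 0 = γ 1
  ne_zero : ∀ t ∈ Set.Icc (0 : ℝ) 1, q (γ t) ≠ 0
  winding : ∃ α β : Fin 2 → ℂ,
    (∀ p, q p = (∑ i, α i * p i) * (∑ i, β i * p i)) ∧
    ∃ θ : ℝ → ℂ, ContinuousOn θ (Set.Icc 0 1) ∧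
      (∀ t ∈ Set.Icc (0 : ℝ) 1,
        (∑ i, α i * γ t i) = Complex.exp (θ t) * (∑ i, β i * γ t i)) ∧
      θ 1 - θ 0 = 2 * Real.pi * Complex.I

/-- The Penrose transform
`φ_{A'₁…A'₂ₕ}(x) = (1/2πi) ∮_γ χ^{-(h+1)} π_{A'₁} … π_{A'₂ₕ} π_{B'} dπ^{B'}`,
where `π_{B'} dπ^{B'} = ε^{B'C'} π_{B'} dπ_{C'}`. -/
def penrose (Q : Matrix TIdx TIdx ℂ) (h : ℕ) (γ : ℝ → Fin 2 → ℂ) (x : Pt ℂ)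
    (idx : Fin (2 * h) → Fin 2) : ℂ :=
  (2 * Real.pi * Complex.I)⁻¹ * ∫ t in (0 : ℝ)..1,
    ((chiOnLine Q x (γ t)) ^ (h + 1))⁻¹ * (∏ k, γ t (idx k)) *
      ∑ B, ∑ C, eps B C * γ t B * deriv (fun s => γ s C) t

/-- The field with `h = 0`. -/
def scalarField (Q : Matrix TIdx TIdx ℂ) (γ : ℝ → Fin 2 → ℂ) (x : Pt ℂ) : ℂ :=
  penrose Q 0 γ x ![]

/-- The field `φ_{A'B'}` with `h = 1`. -/
def spinOneField (Q : Matrix TIdx TIdx ℂ) (γ : ℝ → Fin 2 → ℂ) (x : Pt ℂ) (A B : Fin 2) : ℂ :=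
  penrose Q 1 γ x ![A, B]

/-- The 2-form `-i φ_{A'B'} ε_{AB}` in coordinates, `φ` being the field with `h = 1`. The constant
`-i` is the one for which the form is the fundamental 2-form of a complex structure (`J² = -1`). -/
def quadricForm (Q : Matrix TIdx TIdx ℂ) (γ : ℝ → Fin 2 → ℂ) (x : Pt ℂ) :
    Matrix (Fin 4) (Fin 4) ℂ :=
  Matrix.of fun a b => -Complex.I * ∑ A, ∑ B, ∑ A', ∑ B', spinOneField Q γ x A' B' * eps A B *
    spinorForm (Pi.single a 1) A A' * spinorForm (Pi.single b 1) B B'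

section Generation

variable {𝕜 : Type*} [RCLike 𝕜]

/-- The inclusion of `𝕜⁴` in complexified flat space. -/
def toC (x : Pt 𝕜) : Pt ℂ := fun a => RCLike.map 𝕜 ℂ (x a)

/-- The quadric `Q` generates the conformal factor `Ω` on `U`, with contours `Γ`: near each `p ∈ U`
the fixed contour `Γ p` separates the zeros of `χ` on the twistor lines, and `Ω` is the Penrose
transform with `h = 0`. -/
def GeneratesFactor (Q : Matrix TIdx TIdx ℂ) (U : Set (Pt 𝕜)) (Γ : Pt 𝕜 → ℝ → Fin 2 → ℂ)
    (Ω : Pt 𝕜 → 𝕜) : Prop :=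
  ∀ p ∈ U, ∀ᶠ x in 𝓝 p, IsSeparatingContour (chiOnLine Q (toC x)) (Γ p) ∧
    RCLike.map 𝕜 ℂ (Ω x) = scalarField Q (Γ p) (toC x)

/-- The quadric `Q` generates the 2-form `κ` on `U`, with contours `Γ`, through the Penrose
transform with `h = 1`. -/
def GeneratesForm (Q : Matrix TIdx TIdx ℂ) (U : Set (Pt 𝕜)) (Γ : Pt 𝕜 → ℝ → Fin 2 → ℂ)
    (κ : Pt 𝕜 → Matrix (Fin 4) (Fin 4) 𝕜) : Prop :=
  ∀ p ∈ U, ∀ᶠ x in 𝓝 p, IsSeparatingContour (chiOnLine Q (toC x)) (Γ p) ∧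
    (κ x).map (RCLike.map 𝕜 ℂ) = quadricForm Q (Γ p) (toC x)

end Generation

/-- The quartic polynomial
`¼ a_{AB}a^{AB}(x_a x^a)² + 2i a_{AB} b^B_{A'} x^{AA'} x_c x^c - 2 a_{AB} c_{A'B'} x^{AA'} x^{BB'}
  - 2[(b_a b^a)(x_b x^b) - (b_a x^a)²] + 4i b_A^{B'} c_{A'B'} x^{AA'} + c^{A'B'} c_{A'B'}`.
The arguments are `a = a_{AB}`, `b = b_A^{B'}` (row `A`), `c = c^{A'B'}`. -/
def quartic (a b c : Matrix (Fin 2) (Fin 2) ℂ) (x : Pt ℂ) : ℂ :=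
  let X := spinorForm x
  let x2 := contract (lower₂ X) X
  let bLow := lowerSnd b
  (1 / 4) * contract a (raise₂ a) * x2 ^ 2
    + 2 * Complex.I * (∑ A, ∑ B, ∑ A', a A B * raiseFst bLow B A' * X A A') * x2
    - 2 * (∑ A, ∑ B, ∑ A', ∑ B', a A B * lower₂ c A' B' * X A A' * X B B')
    - 2 * (contract bLow (raiseFst b) * x2 - (contract bLow X) ^ 2)
    + 4 * Complex.I * (∑ A, ∑ A', ∑ B', b A B' * lower₂ c A' B' * X A A')
    + contract (lower₂ c) c

/-- The symmetric matrix with `2i Q_{αβ} Z^α Z^β = a_{AB} ω^A ω^B + 2 b_A^{B'} ω^A π_{B'} +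
c^{A'B'} π_{A'} π_{B'}` (for symmetric `a`, `c`). On twistor lines this reads
`χ = (2i)⁻¹ K^{A'B'} π_{A'} π_{B'}`. -/
def quadricOf (a b c : Matrix (Fin 2) (Fin 2) ℂ) : Matrix TIdx TIdx ℂ :=
  (2 * Complex.I)⁻¹ • Matrix.fromBlocks a b b.transpose c

end TwistorQuadric

end

/-! On the twistor line of x, 2iχ is a binary quadratic form with symmetric matrix K(x). It defines
a self-dual 2-form with components k(x), quadratic in x, and |k|² = det K (`normSq₃_spinorVec`).
These k are exactly the self-dual conformal Killing-Yano (CKY) forms of flat space, with 10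
parameters on both sides (`eval_ckyOf`, `exists_ckyOf_eq`), and the quartic is 2|k|² (`quartic_eq`).
Residues (`contour_integral`) turn the Penrose integrals into algebra: h = 0 gives Ω with Ω²|k|² =
1, and h = 1 gives the form Ω³k (`separating_contour_fields`). The orientation of the contour is the
choice of sign of Ω, so every continuous root Ω is generated (`exists_contour`).

On the Kähler side, write the form as Ω²j with |j| = 1. Closedness and integrability together force
j to be parallel for Ω²η (`eq_parallelPart`). Then k = j/Ω satisfies the CKY equation ∂_a k =
`sdPair` e_a ξ, which integrates to a quadratic polynomial (`exists_cky_eq`). Conversely, if k is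
CKY and Ω²|k|² = 1, then Ωk is parallel (`isConformallyFlatKahler_of_cky`). Conformally flat Kähler
structures are thus CKY forms with a choice of root, that is, quadrics with contours.

For uniqueness, Ω determines N = |k|², and the tensor obstructing flatness of N⁻¹η depends on N
alone. That tensor is a product ν ⊗ k with ν anti-self-dual (`CKY.obstruction_eq`). If k and k' have
the same N, then ν ⊗ k = ν' ⊗ k'. Either k and k' are proportional, hence equal up to sign, or ν = 0
and the metric is flat. The argument runs in a polynomial ring, an integral domain, so the
alternative and the sign are global. -/

open scoped ContDiff Topology

noncomputable section

namespace TwistorQuadric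

/-! ### Self-dual and anti-self-dual forms, and CKY forms as polynomials. -/

section Algebra

variable {R : Type*} [CommRing R]

/-- The squared length of a vector with three components. -/
def normSq₃ (v : Fin 3 → R) : R := v 0 ^ 2 + v 1 ^ 2 + v 2 ^ 2

/-- The self-dual 2-form on `R⁴` with components `v`. -/
def sdForm (v : Fin 3 → R) : Matrix (Fin 4) (Fin 4) R :=
  !![0, v 0, v 1, v 2; -v 0, 0, v 2, -v 1; -v 1, -v 2, 0, v 0; -v 2, v 1, -v 0, 0]

/-- The anti-self-dual 2-form on `R⁴` with components `v`. -/
def asdForm (v : Fin 3 → R) : Matrix (Fin 4) (Fin 4) R :=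
  !![0, v 0, v 1, v 2; -v 0, 0, -v 2, v 1; -v 1, v 2, 0, -v 0; -v 2, -v 1, v 0, 0]

/-- Twice the self-dual part of `x ∧ y`. -/
def sdPair (x y : Fin 4 → R) : Fin 3 → R :=
  ![x 0 * y 1 - x 1 * y 0 + x 2 * y 3 - x 3 * y 2,
    x 0 * y 2 - x 2 * y 0 + x 3 * y 1 - x 1 * y 3,
    x 0 * y 3 - x 3 * y 0 + x 1 * y 2 - x 2 * y 1]

/-- Twice the anti-self-dual part of `x ∧ y`. -/
def asdPair (x y : Fin 4 → R) : Fin 3 → R :=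
  ![x 0 * y 1 - x 1 * y 0 - x 2 * y 3 + x 3 * y 2,
    x 0 * y 2 - x 2 * y 0 - x 3 * y 1 + x 1 * y 3,
    x 0 * y 3 - x 3 * y 0 - x 1 * y 2 + x 2 * y 1]

/-- Parameters of a self-dual conformal Killing-Yano 2-form of flat space. -/
structure CKY (R : Type*) where
  /-- the constant term -/
  c : Fin 3 → R
  /-- the coefficients of the linear term -/
  b : Fin 4 → R
  /-- the coefficients of the quadratic term -/
  α : Fin 3 → R

namespace CKY

/-- The components of the conformal Killing-Yano form at a point. -/
def eval (P : CKY R) (x : Fin 4 → R) : Fin 3 → R :=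
  P.c + sdPair x (P.b + (asdForm P.α).mulVec x)

/-- The vector field `ξ` with `∂_a k = sdPair e_a ξ`. -/
def xi (P : CKY R) (x : Fin 4 → R) : Fin 4 → R := P.b + (2 : R) • (asdForm P.α).mulVec x

/-- Change of coefficients. -/
def map {S : Type*} (f : R → S) (P : CKY R) : CKY S := ⟨f ∘ P.c, f ∘ P.b, f ∘ P.α⟩

theorem eval_apply (P : CKY R) (x : Fin 4 → R) : P.eval x =
    ![P.c 0 + x 0 * (P.b 1 - P.α 0 * x 0 - P.α 2 * x 2 + P.α 1 * x 3)
        - x 1 * (P.b 0 + P.α 0 * x 1 + P.α 1 * x 2 + P.α 2 * x 3)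
        + x 2 * (P.b 3 - P.α 2 * x 0 - P.α 1 * x 1 + P.α 0 * x 2)
        - x 3 * (P.b 2 - P.α 1 * x 0 + P.α 2 * x 1 - P.α 0 * x 3),
      P.c 1 + x 0 * (P.b 2 - P.α 1 * x 0 + P.α 2 * x 1 - P.α 0 * x 3)
        - x 2 * (P.b 0 + P.α 0 * x 1 + P.α 1 * x 2 + P.α 2 * x 3)
        + x 3 * (P.b 1 - P.α 0 * x 0 - P.α 2 * x 2 + P.α 1 * x 3)
        - x 1 * (P.b 3 - P.α 2 * x 0 - P.α 1 * x 1 + P.α 0 * x 2),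
      P.c 2 + x 0 * (P.b 3 - P.α 2 * x 0 - P.α 1 * x 1 + P.α 0 * x 2)
        - x 3 * (P.b 0 + P.α 0 * x 1 + P.α 1 * x 2 + P.α 2 * x 3)
        + x 1 * (P.b 2 - P.α 1 * x 0 + P.α 2 * x 1 - P.α 0 * x 3)
        - x 2 * (P.b 1 - P.α 0 * x 0 - P.α 2 * x 2 + P.α 1 * x 3)] := by
  ext i
  fin_cases i <;>
    simp [eval, sdPair, asdForm, dotProduct, Fin.sum_univ_four] <;> ring

theorem xi_apply (P : CKY R) (x : Fin 4 → R) : P.xi x =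
    ![P.b 0 + 2 * (P.α 0 * x 1 + P.α 1 * x 2 + P.α 2 * x 3),
      P.b 1 + 2 * (-P.α 0 * x 0 - P.α 2 * x 2 + P.α 1 * x 3),
      P.b 2 + 2 * (-P.α 1 * x 0 + P.α 2 * x 1 - P.α 0 * x 3),
      P.b 3 + 2 * (-P.α 2 * x 0 - P.α 1 * x 1 + P.α 0 * x 2)] := by
  ext i
  fin_cases i <;>
    simp [xi, asdForm, dotProduct, Fin.sum_univ_four] <;> ring

theorem map_eval {S : Type*} [CommRing S] (f : R →+* S) (P : CKY R) (x : Fin 4 → R) (i : Fin 3) :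
    f (P.eval x i) = (P.map f).eval (f ∘ x) i := by
  fin_cases i <;> simp [eval_apply, map]

end CKY

/-- The three basis matrices are anticommuting quaternion units, so unit vectors give complex
structures. -/
theorem sdForm_mul_self (v : Fin 3 → R) : sdForm v * sdForm v = -normSq₃ v • 1 := by
  ext i j
  fin_cases i <;> fin_cases j <;>
    simp [sdForm, normSq₃, Matrix.mul_apply, Fin.sum_univ_four] <;> ring

theorem sdForm_transpose (v : Fin 3 → R) : (sdForm v).transpose = -sdForm v := by
  ext i j
  fin_cases i <;> fin_cases j <;> simp [sdForm]

theorem sdForm_smul (s : R) (v : Fin 3 → R) : sdForm (s • v) = s • sdForm v := by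
  ext i j
  fin_cases i <;> fin_cases j <;> simp [sdForm]

theorem sdForm_neg (v : Fin 3 → R) : sdForm (-v) = -sdForm v := by
  ext i j
  fin_cases i <;> fin_cases j <;> simp [sdForm]

end Algebra

/-! ## Quadrics on twistor lines -/

section Spinors

open Complex

/-- The symmetric spinor `K^{A'B'}` with `2i χ = K^{A'B'} π_{A'} π_{B'}` on a twistor line. -/
def lineSpinor (a b c X : Matrix (Fin 2) (Fin 2) ℂ) : Matrix (Fin 2) (Fin 2) ℂ :=
  -(X.transpose * a * X) + I • (X.transpose * b + b.transpose * X) + c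

/-- The components of the self-dual 2-form defined by a symmetric spinor. -/
def spinorVec (K : Matrix (Fin 2) (Fin 2) ℂ) : Fin 3 → ℂ :=
  ![I / 2 * (K 0 0 - K 1 1), -(K 0 0 + K 1 1) / 2, -I * K 0 1]

/-- The conformal Killing-Yano parameters of a twistor quadric. -/
def ckyOf (a b c : Matrix (Fin 2) (Fin 2) ℂ) : CKY ℂ where
  c := spinorVec c
  b := ((Real.sqrt 2 : ℝ) : ℂ)⁻¹ •
    ![I * (b 0 1 - b 1 0), b 1 1 - b 0 0, -I * (b 0 0 + b 1 1), b 1 0 + b 0 1]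
  α := ![I / 4 * (a 0 0 - a 1 1), -(a 0 0 + a 1 1) / 4, -I / 2 * a 0 1]

theorem sqrt_two_inv_sq : (((Real.sqrt 2 : ℝ) : ℂ)⁻¹) ^ 2 = 1 / 2 := by
  rw [inv_pow, ← Complex.ofReal_pow, Real.sq_sqrt (by norm_num)]; norm_num

theorem normSq₃_spinorVec {K : Matrix (Fin 2) (Fin 2) ℂ} (hK : K.IsSymm) :
    normSq₃ (spinorVec K) = K.det := by
  have h : K 1 0 = K 0 1 := hK.apply 0 1
  simp only [normSq₃, spinorVec, Matrix.det_fin_two, h, Matrix.cons_val]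
  ring_nf
  simp only [I_sq]
  ring

theorem lineSpinor_isSymm {a b c : Matrix (Fin 2) (Fin 2) ℂ} (ha : a.IsSymm) (hc : c.IsSymm)
    (X : Matrix (Fin 2) (Fin 2) ℂ) : (lineSpinor a b c X).IsSymm := by
  simp [Matrix.IsSymm, lineSpinor, Matrix.mul_assoc, ha.eq, hc.eq, add_comm]

/-- Putting ω = iXπ in the quadric makes c, b, a the constant, linear and quadratic terms in X,
which match the three terms of a CKY form. The two factors 1/√2 in the quadratic term are absorbed
by `sqrt_two_inv_sq`. -/
theorem eval_ckyOf {a b c : Matrix (Fin 2) (Fin 2) ℂ} (ha : a.IsSymm)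
    (x : Pt ℂ) : (ckyOf a b c).eval x = spinorVec (lineSpinor a b c (spinorForm x)) := by
  have ha' : a 1 0 = a 0 1 := ha.apply 0 1
  have hs := sqrt_two_inv_sq
  have hI := I_sq
  have hI5 : I ^ 5 = I := by rw [pow_succ, I_pow_four, one_mul]
  ext i
  rw [CKY.eval_apply]
  generalize hs' : (((Real.sqrt 2 : ℝ) : ℂ)⁻¹) = s at *
  fin_cases i <;>
    simp [spinorVec, lineSpinor, ckyOf, spinorForm, Matrix.mul_apply, Fin.sum_univ_two, ha', hs'] <;>
    ring_nf <;> simp only [hI, hs, I_pow_three, I_pow_four, hI5] <;> ring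

/-- Both sides are the full contraction K_{A'B'}K^{A'B'} = 2 det K of the spinor on the line. -/
theorem quartic_eq {a b c : Matrix (Fin 2) (Fin 2) ℂ} (ha : a.IsSymm) (hc : c.IsSymm)
    (x : Pt ℂ) : quartic a b c x = 2 * normSq₃ ((ckyOf a b c).eval x) := by
  rw [eval_ckyOf ha, normSq₃_spinorVec (lineSpinor_isSymm ha hc _)]
  have ha' : a 1 0 = a 0 1 := ha.apply 0 1
  have hc' : c 1 0 = c 0 1 := hc.apply 0 1
  simp only [quartic]
  generalize spinorForm x = X
  simp [Matrix.det_fin_two, lineSpinor, contract, lower₂, raise₂, lowerSnd, raiseFst, eps,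
    Matrix.mul_apply, Fin.sum_univ_two, ha', hc']
  ring_nf
  simp only [I_sq]
  ring

theorem chiOnLine_quadricOf {a b c : Matrix (Fin 2) (Fin 2) ℂ} (ha : a.IsSymm) (hc : c.IsSymm)
    (x : Pt ℂ) (p : Fin 2 → ℂ) : chiOnLine (quadricOf a b c) x p =
      (2 * I)⁻¹ * (lineSpinor a b c (spinorForm x) 0 0 * p 0 ^ 2
        + 2 * lineSpinor a b c (spinorForm x) 0 1 * p 0 * p 1
        + lineSpinor a b c (spinorForm x) 1 1 * p 1 ^ 2) := by
  have ha' : a 1 0 = a 0 1 := ha.apply 0 1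
  have hc' : c 1 0 = c 0 1 := hc.apply 0 1
  generalize hX : spinorForm x = X
  simp [chiOnLine, chi, quadricOf, twistorOn, hX, lineSpinor, Matrix.mul_apply, Fin.sum_univ_two,
    ha', hc']
  ring_nf
  simp only [I_pow_three]
  ring

/-- A quadric A_α A_β restricts to a perfect square on every twistor line, so det K would vanish
identically. -/
theorem isTwistorQuadric_quadricOf {a b c : Matrix (Fin 2) (Fin 2) ℂ} (ha : a.IsSymm)
    (hc : c.IsSymm) {x : Pt ℂ} (hx : normSq₃ ((ckyOf a b c).eval x) ≠ 0) :
    IsTwistorQuadric (quadricOf a b c) := by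
  refine ⟨?_, ?_⟩
  · simp [Matrix.IsSymm, quadricOf, Matrix.fromBlocks_transpose, ha.eq, hc.eq]
  · rintro ⟨A, hA⟩
    apply hx
    have h2 : (2 * I) ≠ 0 := by simp
    have key : ∀ α β, Matrix.fromBlocks a b b.transpose c α β = 2 * I * (A α * A β) := by
      intro α β
      rw [← hA]
      simp only [quadricOf, Matrix.smul_apply, smul_eq_mul]
      rw [mul_inv_cancel_left₀ h2]
    rw [eval_ckyOf ha, normSq₃_spinorVec (lineSpinor_isSymm ha hc _)]
    have e1 : ∀ i j, a i j = 2 * I * (A (.inl i) * A (.inl j)) := fun i j => key (.inl i) (.inl j)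
    have e2 : ∀ i j, b i j = 2 * I * (A (.inl i) * A (.inr j)) := fun i j => key (.inl i) (.inr j)
    have e3 : ∀ i j, c i j = 2 * I * (A (.inr i) * A (.inr j)) := fun i j => key (.inr i) (.inr j)
    generalize spinorForm x = X
    simp [Matrix.det_fin_two, lineSpinor, Matrix.mul_apply, Fin.sum_univ_two, e1, e2, e3]
    ring_nf
    simp only [I_sq, I_pow_four]
    ring

/-- The 3 + 4 + 3 parameters of P correspond linearly to the 3 + 4 + 3 entries of c, b, a; the
witnesses invert the formulas of `ckyOf`. -/
theorem exists_ckyOf_eq (P : CKY ℂ) : ∃ a b c : Matrix (Fin 2) (Fin 2) ℂ,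
    a.IsSymm ∧ c.IsSymm ∧ ckyOf a b c = P := by
  obtain ⟨c, b, α⟩ := P
  have hs : ((Real.sqrt 2 : ℝ) : ℂ) ≠ 0 := by simp
  set s := ((Real.sqrt 2 : ℝ) : ℂ)
  refine ⟨!![-2 * I * α 0 - 2 * α 1, 2 * I * α 2; 2 * I * α 2, 2 * I * α 0 - 2 * α 1],
    !![s * (I * b 2 - b 1) / 2, s * (b 3 - I * b 0) / 2; s * (b 3 + I * b 0) / 2,
      s * (I * b 2 + b 1) / 2],
    !![-I * c 0 - c 1, I * c 2; I * c 2, I * c 0 - c 1], ?_, ?_, ?_⟩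
  · simp [Matrix.IsSymm, ← Matrix.ext_iff, Fin.forall_fin_two]
  · simp [Matrix.IsSymm, ← Matrix.ext_iff, Fin.forall_fin_two]
  · have hI : I * I = -1 := I_mul_I
    simp only [ckyOf, CKY.mk.injEq]
    refine ⟨?_, ?_, ?_⟩
    · ext i; fin_cases i <;> simp [spinorVec]
      · linear_combination -c 0 * hI
      · linear_combination -c 2 * hI
    · ext i; fin_cases i <;> simp <;> field_simp
      · linear_combination -2 * s * b 0 * hI
      · ring
      · linear_combination -2 * s * b 2 * hI
      · ring
    · ext i; fin_cases i <;> simp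
      · linear_combination -α 0 * hI
      · ring
      · linear_combination -α 2 * hI

end Spinors

/-! ### Residue evaluation of the Penrose transform. -/

section Penrose

open Complex MeasureTheory

/-- At the endpoints `deriv` of a contour depends on its values outside [0,1], so F' is controlled
only inside. G is a substitute for it that is continuous up to the endpoints. -/
theorem integral_of_hasDerivAt_Ioo {F F' G : ℝ → ℂ} (hF : ContinuousOn F (Set.Icc 0 1))
    (hd : ∀ t ∈ Set.Ioo (0 : ℝ) 1, HasDerivAt F (F' t) t)
    (hG : ContinuousOn G (Set.Icc 0 1)) (hFG : ∀ t ∈ Set.Ioo (0 : ℝ) 1, F' t = G t) :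
    ∫ t in (0 : ℝ)..1, F' t = F 1 - F 0 := by
  have hGi : IntervalIntegrable G volume 0 1 :=
    ContinuousOn.intervalIntegrable (by rwa [Set.uIcc_of_le zero_le_one])
  rw [← intervalIntegral.integral_eq_sub_of_hasDerivAt_of_le zero_le_one hF
    (fun t ht => hFG t ht ▸ hd t ht) hGi]
  exact intervalIntegral.integral_congr_Ioo_of_le zero_le_one (fun t ht => hFG t ht)

/-- A continuous logarithm of a quotient of differentiable functions is differentiable. -/
theorem hasDerivAt_of_exp_mul_eq {θ u v : ℝ → ℂ} {t : ℝ} {u' v' : ℂ} (hθ : ContinuousAt θ t)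
    (hu : HasDerivAt u u' t) (hv : HasDerivAt v v' t) (hv0 : v t ≠ 0)
    (h : ∀ᶠ s in 𝓝 t, u s = exp (θ s) * v s) :
    HasDerivAt θ (u' / u t - v' / v t) t := by
  have hut : u t = exp (θ t) * v t := h.self_of_nhds
  have hu0 : u t ≠ 0 := by rw [hut]; exact mul_ne_zero (exp_ne_zero _) hv0
  -- Normalised to be 1 at t, the quotient u/v has a differentiable principal logarithm there. It
  -- equals θ s - θ t as long as the imaginary part of the latter stays below π.
  have hr : HasDerivAt (fun s => u s / v s * (v t / u t)) _ t :=
    (hu.div hv hv0).mul_const (v t / u t)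
  have hr1 : u t / v t * (v t / u t) = 1 := by field_simp
  have hl := (hr.clog_real (by rw [hr1]; exact one_mem_slitPlane)).const_add (θ t)
  have hev : ∀ᶠ s in 𝓝 t, |(θ s - θ t).im| < Real.pi := by
    have hc : ContinuousAt (fun s => |(θ s - θ t).im|) t := by fun_prop
    have : |(θ t - θ t).im| < Real.pi := by simp [Real.pi_pos]
    exact hc.eventually_lt_const this
  refine (hl.congr_deriv ?_).congr_of_eventuallyEq ?_
  · rw [hr1]
    field_simp
  · filter_upwards [hev, h, hv.continuousAt.eventually_ne hv0] with s hs hus hvs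
    rw [abs_lt] at hs
    have : u s / v s * (v t / u t) = exp (θ s - θ t) := by
      rw [hus, hut, exp_sub]
      have := exp_ne_zero (θ t)
      field_simp
    rw [this, log_exp hs.1 hs.2.le]
    ring

/-- Residue calculus along a contour that separates the zeros of the product of two linear
forms. -/
theorem contour_integral {γ : ℝ → Fin 2 → ℂ} (hγ : ContDiffOn ℝ 1 γ (Set.Icc 0 1)) {α β : Fin 2 → ℂ}
    (hne : ∀ t ∈ Set.Icc (0 : ℝ) 1, (∑ i, α i * γ t i) * (∑ i, β i * γ t i) ≠ 0) {θ : ℝ → ℂ}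
    (hθ : ContinuousOn θ (Set.Icc 0 1))
    (hexp : ∀ t ∈ Set.Icc (0 : ℝ) 1,
      (∑ i, α i * γ t i) = exp (θ t) * (∑ i, β i * γ t i))
    (hw : θ 1 - θ 0 = 2 * Real.pi * I) :
    α 0 * β 1 - α 1 * β 0 ≠ 0 ∧ ∀ (m : ℝ → ℂ) (A B C : ℂ),
      (∀ t, m t = A * (∑ i, α i * γ t i) ^ 2 + B * ((∑ i, α i * γ t i) * (∑ i, β i * γ t i))
        + C * (∑ i, β i * γ t i) ^ 2) →
      ∫ t in (0 : ℝ)..1, ((((∑ i, α i * γ t i) * (∑ i, β i * γ t i)) ^ 2)⁻¹ * m t *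
        ∑ i, ∑ j, eps i j * γ t i * deriv (fun s => γ s j) t) =
        -(B / (α 0 * β 1 - α 1 * β 0)) * (2 * Real.pi * I) := by
  have hγi : ∀ i, ContDiffOn ℝ 1 (fun t => γ t i) (Set.Icc 0 1) := fun i =>
    contDiffOn_pi.1 hγ i
  have hγc : ∀ i, ContinuousOn (fun t => γ t i) (Set.Icc 0 1) := fun i => (hγi i).continuousOn
  have hγd : ∀ i, ∀ t ∈ Set.Ioo (0 : ℝ) 1,
      HasDerivAt (fun s => γ s i) (deriv (fun s => γ s i) t) t := fun i t ht =>
    (((hγi i).differentiableOn one_ne_zero t (Set.Ioo_subset_Icc_self ht)).differentiableAt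
      (Icc_mem_nhds ht.1 ht.2)).hasDerivAt
  -- The one-sided derivative is continuous on all of [0,1] and agrees with `deriv` inside.
  have hγw : ∀ i, ContinuousOn (derivWithin (fun s => γ s i) (Set.Icc 0 1)) (Set.Icc 0 1) :=
    fun i => (hγi i).continuousOn_derivWithin (uniqueDiffOn_Icc zero_lt_one) le_rfl
  have hγe : ∀ i, ∀ t ∈ Set.Ioo (0 : ℝ) 1,
      deriv (fun s => γ s i) t = derivWithin (fun s => γ s i) (Set.Icc 0 1) t := fun i t ht =>
    (derivWithin_of_mem_nhds (Icc_mem_nhds ht.1 ht.2)).symm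
  set D := α 0 * β 1 - α 1 * β 0 with hD
  simp only [Fin.sum_univ_two] at *
  set u : ℝ → ℂ := fun t => α 0 * γ t 0 + α 1 * γ t 1 with hu
  set v : ℝ → ℂ := fun t => β 0 * γ t 0 + β 1 * γ t 1 with hv
  have hu0 : ∀ t ∈ Set.Icc (0 : ℝ) 1, u t ≠ 0 := fun t ht => left_ne_zero_of_mul (hne t ht)
  have hv0 : ∀ t ∈ Set.Icc (0 : ℝ) 1, v t ≠ 0 := fun t ht => right_ne_zero_of_mul (hne t ht)
  have huc : ContinuousOn u (Set.Icc 0 1) := by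
    exact ((hγc 0).const_smul (α 0)).add ((hγc 1).const_smul (α 1))
  have hvc : ContinuousOn v (Set.Icc 0 1) := by
    exact ((hγc 0).const_smul (β 0)).add ((hγc 1).const_smul (β 1))
  -- θ is a logarithm of u/v, so θ' = (u'v - uv')/(uv), and this Wronskian is -D times π·dπ.
  have hθd : ∀ t ∈ Set.Ioo (0 : ℝ) 1, HasDerivAt θ
      (-D * (γ t 0 * deriv (fun s => γ s 1) t - γ t 1 * deriv (fun s => γ s 0) t)
        / (u t * v t)) t := by
    intro t ht
    have ht' := Set.Ioo_subset_Icc_self ht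
    have h0 := hγd 0 t ht
    have h1 := hγd 1 t ht
    refine (hasDerivAt_of_exp_mul_eq (hθ.continuousAt (Icc_mem_nhds ht.1 ht.2))
      ((h0.const_mul (α 0)).add (h1.const_mul (α 1)))
      ((h0.const_mul (β 0)).add (h1.const_mul (β 1))) (hv0 t ht') ?_).congr_deriv ?_
    · filter_upwards [Icc_mem_nhds ht.1 ht.2] with s hs using hexp s hs
    · have hu1 := hu0 t ht'
      have hv1 := hv0 t ht'
      simp only [Pi.add_apply]
      change _ / u t - _ / v t = _
      field_simp
      simp only [hu, hv, hD]
      ring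
  have hwc : ContinuousOn (fun t => γ t 0 * derivWithin (fun s => γ s 1) (Set.Icc 0 1) t
      - γ t 1 * derivWithin (fun s => γ s 0) (Set.Icc 0 1) t) (Set.Icc 0 1) :=
    ((hγc 0).mul (hγw 1)).sub ((hγc 1).mul (hγw 0))
  -- For D = 0 the function θ would be constant and could not grow by 2πi.
  have hDne : D ≠ 0 := by
    intro h0
    have := integral_of_hasDerivAt_Ioo hθ hθd (G := fun _ => 0) continuousOn_const
      (fun t _ => by simp [h0])
    rw [intervalIntegral.integral_congr (g := fun _ => 0) (fun t _ => by simp [h0]), hw] at this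
    simp [Real.pi_ne_zero] at this
  refine ⟨hDne, fun m A B C hm => ?_⟩
  have hmc : ContinuousOn m (Set.Icc 0 1) := by
    rw [show m = fun t => A * u t ^ 2 + B * (u t * v t) + C * v t ^ 2 from funext hm]
    fun_prop
  -- With e^θ = u/v, the integrand is -(A e^θ + B + C e^{-θ}) θ'/D, which has an explicit primitive.
  have hFd : ∀ t ∈ Set.Ioo (0 : ℝ) 1, HasDerivAt
      (fun t => -(A * exp (θ t) + B * θ t - C * exp (-θ t)) / D)
      (((u t * v t) ^ 2)⁻¹ * m t *
        (eps 0 0 * γ t 0 * deriv (fun s => γ s 0) t + eps 0 1 * γ t 0 * deriv (fun s => γ s 1) t +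
        (eps 1 0 * γ t 1 * deriv (fun s => γ s 0) t
          + eps 1 1 * γ t 1 * deriv (fun s => γ s 1) t))) t := by
    intro t ht
    have ht' := Set.Ioo_subset_Icc_self ht
    have h := hθd t ht
    refine (((((h.cexp.const_mul A).add (h.const_mul B)).sub
      (h.neg.cexp.const_mul C)).neg).div_const D).congr_deriv ?_
    have hu1 := hu0 t ht'
    have hv1 := hv0 t ht'
    have e1 : exp (θ t) = u t / v t := by
      rw [eq_div_iff hv1]; exact (hexp t ht').symm
    simp only [Pi.neg_apply]
    rw [exp_neg, e1, hm]
    change _ = ((u t * v t) ^ 2)⁻¹ * (A * u t ^ 2 + B * (u t * v t) + C * v t ^ 2) * _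
    simp only [eps, Matrix.of_apply, Matrix.cons_val', Matrix.cons_val_zero, Matrix.cons_val_one,
      Matrix.cons_val_fin_one]
    field_simp
    ring
  have hFc : ContinuousOn (fun t => -(A * exp (θ t) + B * θ t - C * exp (-θ t)) / D)
      (Set.Icc 0 1) := by fun_prop
  have hGc : ContinuousOn (fun t => ((u t * v t) ^ 2)⁻¹ * m t *
      (γ t 0 * derivWithin (fun s => γ s 1) (Set.Icc 0 1) t
      - γ t 1 * derivWithin (fun s => γ s 0) (Set.Icc 0 1) t)) (Set.Icc 0 1) := by
    refine ContinuousOn.mul (ContinuousOn.mul ?_ hmc) hwc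
    exact ContinuousOn.inv₀ (by fun_prop) (fun t ht => pow_ne_zero 2 (hne t ht))
  have key := integral_of_hasDerivAt_Ioo hFc hFd hGc (fun t ht => by
    rw [← hγe 0 t ht, ← hγe 1 t ht]
    simp only [eps, Matrix.of_apply, Matrix.cons_val', Matrix.cons_val_zero, Matrix.cons_val_one,
      Matrix.cons_val_fin_one]
    ring)
  rw [key]
  -- The exponential terms return to their values, so only the term Bθ contributes to the integral.
  have hE : exp (θ 1) = exp (θ 0) := by
    rw [show θ 1 = θ 0 + 2 * Real.pi * I by rw [← hw]; ring, exp_periodic]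
  rw [exp_neg, exp_neg, hE, ← hw]
  field_simp
  ring

/-- The Penrose transform with `h = 0` along a separating contour. -/
theorem scalarField_eq {Q : Matrix TIdx TIdx ℂ} {x : Pt ℂ} {γ : ℝ → Fin 2 → ℂ}
    (hγ : ContDiffOn ℝ 1 γ (Set.Icc 0 1)) {α β : Fin 2 → ℂ}
    (hq : ∀ p, chiOnLine Q x p = (∑ i, α i * p i) * (∑ i, β i * p i))
    (hne : ∀ t ∈ Set.Icc (0 : ℝ) 1, chiOnLine Q x (γ t) ≠ 0) {θ : ℝ → ℂ}
    (hθ : ContinuousOn θ (Set.Icc 0 1))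
    (hexp : ∀ t ∈ Set.Icc (0 : ℝ) 1,
      (∑ i, α i * γ t i) = exp (θ t) * (∑ i, β i * γ t i))
    (hw : θ 1 - θ 0 = 2 * Real.pi * I) :
    α 0 * β 1 - α 1 * β 0 ≠ 0 ∧ scalarField Q γ x = -(α 0 * β 1 - α 1 * β 0)⁻¹ := by
  simp only [hq] at hne
  obtain ⟨hD, hint⟩ := contour_integral hγ hne hθ hexp hw
  refine ⟨hD, ?_⟩
  -- 1/(uv) is written as uv/(uv)², so h = 0 is the case A = C = 0, B = 1.
  have h := hint (fun t => (∑ i, α i * γ t i) * (∑ i, β i * γ t i)) 0 1 0 (fun t => by ring)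
  have hπ : (2 * Real.pi * I : ℂ) ≠ 0 := two_pi_I_ne_zero
  rw [scalarField, penrose, inv_mul_eq_iff_eq_mul₀ hπ]
  calc _ = _ := intervalIntegral.integral_congr fun t ht => by
        rw [Set.uIcc_of_le zero_le_one] at ht
        have := hne t ht
        simp only [hq]
        rw [show ((((∑ i, α i * γ t i) * (∑ i, β i * γ t i)) ^ (0 + 1))⁻¹ : ℂ) =
          (((∑ i, α i * γ t i) * (∑ i, β i * γ t i)) ^ 2)⁻¹ *
            ((∑ i, α i * γ t i) * (∑ i, β i * γ t i)) by rw [zero_add, pow_one]; field_simp]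
        simp only [Nat.mul_zero, Finset.univ_eq_empty, Finset.prod_empty, mul_one]
    _ = _ := h
    _ = _ := by rw [one_div]; ring

/-- The Penrose transform with `h = 1` along a separating contour. -/
theorem spinOneField_eq {Q : Matrix TIdx TIdx ℂ} {x : Pt ℂ} {γ : ℝ → Fin 2 → ℂ}
    (hγ : ContDiffOn ℝ 1 γ (Set.Icc 0 1)) {α β : Fin 2 → ℂ}
    (hq : ∀ p, chiOnLine Q x p = (∑ i, α i * p i) * (∑ i, β i * p i))
    (hne : ∀ t ∈ Set.Icc (0 : ℝ) 1, chiOnLine Q x (γ t) ≠ 0) {θ : ℝ → ℂ}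
    (hθ : ContinuousOn θ (Set.Icc 0 1))
    (hexp : ∀ t ∈ Set.Icc (0 : ℝ) 1,
      (∑ i, α i * γ t i) = exp (θ t) * (∑ i, β i * γ t i))
    (hw : θ 1 - θ 0 = 2 * Real.pi * I) (i j : Fin 2) :
    spinOneField Q γ x i j = -((!![-2 * (α 1 * β 1), α 0 * β 1 + α 1 * β 0;
      α 0 * β 1 + α 1 * β 0, -2 * (α 0 * β 0)] : Matrix (Fin 2) (Fin 2) ℂ) i j)
        * ((α 0 * β 1 - α 1 * β 0)⁻¹) ^ 3 := by
  simp only [hq] at hne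
  obtain ⟨hD, hint⟩ := contour_integral hγ hne hθ hexp hw
  have hπ : (2 * Real.pi * I : ℂ) ≠ 0 := two_pi_I_ne_zero
  -- Since p 0 = (β 1 u - α 1 v)/D and p 1 = (α 0 v - β 0 u)/D, each product p i p j is a
  -- combination of u², uv, v². The residue is read off from its uv coefficient.
  have key : ∀ A B C : ℂ, (∀ p : Fin 2 → ℂ, p i * p j =
      A * (∑ i, α i * p i) ^ 2 + B * ((∑ i, α i * p i) * (∑ i, β i * p i))
        + C * (∑ i, β i * p i) ^ 2) →
      spinOneField Q γ x i j = -(B / (α 0 * β 1 - α 1 * β 0)) := by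
    intro A B C hABC
    have h := hint (fun t => γ t i * γ t j) A B C (fun t => hABC (γ t))
    rw [spinOneField, penrose, inv_mul_eq_iff_eq_mul₀ hπ, mul_comm _ (-(_ / _)), ← h]
    refine intervalIntegral.integral_congr fun t _ => ?_
    simp only [hq]
    have : (∏ k : Fin (2 * 1), γ t (![i, j] k)) = γ t i * γ t j := by
      exact Fin.prod_univ_two (fun k : Fin 2 => γ t (![i, j] k))
    rw [this]
  set D := α 0 * β 1 - α 1 * β 0 with hDdef
  simp only [Fin.sum_univ_two] at key
  fin_cases i <;> fin_cases j
  · rw [key (β 1 ^ 2 / D ^ 2) (-2 * (α 1 * β 1) / D ^ 2) (α 1 ^ 2 / D ^ 2)]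
    · simp; field_simp
    · intro p; simp; field_simp; rw [hDdef]; ring
  · rw [key (-(β 0 * β 1) / D ^ 2) ((α 0 * β 1 + α 1 * β 0) / D ^ 2) (-(α 0 * α 1) / D ^ 2)]
    · simp; field_simp; ring
    · intro p; simp; field_simp; rw [hDdef]; ring
  · rw [key (-(β 0 * β 1) / D ^ 2) ((α 0 * β 1 + α 1 * β 0) / D ^ 2) (-(α 0 * α 1) / D ^ 2)]
    · simp; field_simp; ring
    · intro p; simp; field_simp; rw [hDdef]; ring
  · rw [key (β 0 ^ 2 / D ^ 2) (-2 * (α 0 * β 0) / D ^ 2) (α 0 ^ 2 / D ^ 2)]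
    · simp; field_simp
    · intro p; simp; field_simp; rw [hDdef]; ring

/-- The form generated by a quadric, in terms of the generated scalar. -/
theorem separating_contour_fields {a b c : Matrix (Fin 2) (Fin 2) ℂ} (ha : a.IsSymm)
    (hc : c.IsSymm) {x : Pt ℂ} {γ : ℝ → Fin 2 → ℂ}
    (h : IsSeparatingContour (chiOnLine (quadricOf a b c) x) γ) :
    scalarField (quadricOf a b c) γ x ^ 2 * normSq₃ ((ckyOf a b c).eval x) = 1 ∧
    quadricForm (quadricOf a b c) γ x =
      scalarField (quadricOf a b c) γ x ^ 3 • sdForm ((ckyOf a b c).eval x) := by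
  obtain ⟨hγ, -, hne, α, β, hq, θ, hθ, hexp, hw⟩ := h
  obtain ⟨hD, hS⟩ := scalarField_eq hγ hq hne hθ hexp hw
  have hT := spinOneField_eq hγ hq hne hθ hexp hw
  -- K is 2i times the symmetrised product of α and β. Hence det K = D², and the h = 1 residues are,
  -- up to a constant, the entries of K with both indices lowered, divided by D³.
  rw [eval_ckyOf ha, normSq₃_spinorVec (lineSpinor_isSymm ha hc _), Matrix.det_fin_two, hS]
  have h10 : lineSpinor a b c (spinorForm x) 1 0 = lineSpinor a b c (spinorForm x) 0 1 :=
    (lineSpinor_isSymm ha hc _).apply 0 1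
  simp only [chiOnLine_quadricOf ha hc, Fin.sum_univ_two] at hq
  rw [h10]
  generalize lineSpinor a b c (spinorForm x) = K at hq ⊢
  have h2 : (2 * I) ≠ 0 := by simp
  have hI : I ^ 2 = -1 := I_sq
  have e0 : K 0 0 = 2 * I * (α 0 * β 0) := by
    have := hq ![1, 0]
    simp only [Matrix.cons_val_zero, Matrix.cons_val_one] at this
    rw [inv_mul_eq_iff_eq_mul₀ h2] at this
    linear_combination this
  have e1 : K 1 1 = 2 * I * (α 1 * β 1) := by
    have := hq ![0, 1]
    simp only [Matrix.cons_val_zero, Matrix.cons_val_one] at this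
    rw [inv_mul_eq_iff_eq_mul₀ h2] at this
    linear_combination this
  have e2 : K 0 1 = I * (α 0 * β 1 + α 1 * β 0) := by
    have := hq ![1, 1]
    simp only [Matrix.cons_val_zero, Matrix.cons_val_one] at this
    rw [inv_mul_eq_iff_eq_mul₀ h2] at this
    linear_combination (this - e0 - e1) / 2
  constructor
  · rw [e0, e1, e2]
    field_simp
    linear_combination (-(α 0 * β 1 - α 1 * β 0) ^ 2) * hI
  · have hs := sqrt_two_inv_sq
    ext i j
    simp only [quadricForm, Matrix.of_apply, hT]
    generalize (α 0 * β 1 - α 1 * β 0)⁻¹ = d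
    generalize hs' : (((Real.sqrt 2 : ℝ) : ℂ)⁻¹) = s at *
    fin_cases i <;> fin_cases j <;>
      simp [spinorForm, spinorVec, sdForm, eps, Fin.sum_univ_two, e0, e1, e2, hs'] <;>
      ring_nf <;> simp only [hI, hs, I_pow_three] <;> ring

end Penrose

/-! ### Construction of separating contours that stay fixed near a point. -/

section Contours

open Complex

/-- A binary quadratic form with discriminant `δ²` is a product of two linear forms with
determinant `δ`. -/
theorem exists_linear_factors {A B C δ : ℂ} (h : δ ^ 2 = B ^ 2 - 4 * A * C) :
    ∃ α β : Fin 2 → ℂ, α 0 * β 0 = A ∧ α 0 * β 1 + α 1 * β 0 = B ∧ α 1 * β 1 = C ∧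
      α 0 * β 1 - α 1 * β 0 = δ := by
  by_cases hA : A = 0
  · by_cases hC : C = 0
    · have : (δ - B) * (δ + B) = 0 := by subst hA; linear_combination h
      rcases mul_eq_zero.1 this with h1 | h1
      · exact ⟨![B, 0], ![0, 1], by simp [hA], by simp, by simp [hC],
          by simp; linear_combination -h1⟩
      · exact ⟨![0, B], ![1, 0], by simp [hA], by simp, by simp [hC],
          by simp; linear_combination -h1⟩
    · exact ⟨![(B + δ) / 2, C], ![(B - δ) / (2 * C), 1],
        by simp; field_simp; linear_combination -h,
        by simp; field_simp; ring, by simp, by simp; field_simp; ring⟩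
  · exact ⟨![A, (B - δ) / 2], ![1, (B + δ) / (2 * A)],
        by simp, by simp; field_simp; ring, by simp; field_simp; linear_combination -h,
        by simp; field_simp; ring⟩

/-- The circle `α·π = e^{2πit}, β·π = 1` around the zero of `α`. -/
def circleContour (α β : Fin 2 → ℂ) (t : ℝ) : Fin 2 → ℂ :=
  (α 0 * β 1 - α 1 * β 0)⁻¹ • ![β 1 * exp (2 * Real.pi * I * t) - α 1,
    α 0 - β 0 * exp (2 * Real.pi * I * t)]

theorem circleContour_fst {α β : Fin 2 → ℂ} (hD : α 0 * β 1 - α 1 * β 0 ≠ 0) (t : ℝ) :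
    α 0 * circleContour α β t 0 + α 1 * circleContour α β t 1 = exp (2 * Real.pi * I * t) := by
  simp only [circleContour, Pi.smul_apply, smul_eq_mul, Matrix.cons_val_zero, Matrix.cons_val_one]
  field_simp
  ring

theorem circleContour_snd {α β : Fin 2 → ℂ} (hD : α 0 * β 1 - α 1 * β 0 ≠ 0) (t : ℝ) :
    β 0 * circleContour α β t 0 + β 1 * circleContour α β t 1 = 1 := by
  simp only [circleContour, Pi.smul_apply, smul_eq_mul, Matrix.cons_val_zero, Matrix.cons_val_one]
  linear_combination inv_mul_cancel₀ hD

theorem contDiff_circleContour (α β : Fin 2 → ℂ) : ContDiff ℝ 1 (circleContour α β) := by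
  have he : ContDiff ℝ 1 (fun t : ℝ => exp (2 * Real.pi * I * t)) :=
    (contDiff_const.mul ofRealCLM.contDiff).cexp
  rw [contDiff_pi]
  intro i
  fin_cases i
  · exact contDiff_const.mul ((contDiff_const.mul he).sub contDiff_const)
  · exact contDiff_const.mul (contDiff_const.sub (contDiff_const.mul he))

theorem circleContour_closed (α β : Fin 2 → ℂ) : circleContour α β 0 = circleContour α β 1 := by
  simp [circleContour]

/-- A small perturbation of a product of linear forms factorizes explicitly, and the circle
contour of the product separates its zeros. -/
theorem circleContour_perturb {α β : Fin 2 → ℂ} (hD : α 0 * β 1 - α 1 * β 0 ≠ 0)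
    {q : (Fin 2 → ℂ) → ℂ} {A B C s : ℂ}
    (hq : ∀ p, q p = A * (α 0 * p 0 + α 1 * p 1) ^ 2
      + B * ((α 0 * p 0 + α 1 * p 1) * (β 0 * p 0 + β 1 * p 1))
      + C * (β 0 * p 0 + β 1 * p 1) ^ 2)
    (hs : s ^ 2 = B ^ 2 - 4 * A * C) (hm : (B + s) / 2 ≠ 0) (hC : ‖C / ((B + s) / 2)‖ < 1)
    (hA : ‖A / ((B + s) / 2)‖ < 1) :
    ∃ α' β' : Fin 2 → ℂ, α' 0 * β' 1 - α' 1 * β' 0 = s * (α 0 * β 1 - α 1 * β 0) ∧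
      (∀ p, q p = (∑ i, α' i * p i) * (∑ i, β' i * p i)) ∧
      (∀ t ∈ Set.Icc (0 : ℝ) 1, q (circleContour α β t) ≠ 0) ∧
      ∃ θ : ℝ → ℂ, ContinuousOn θ (Set.Icc 0 1) ∧
      (∀ t ∈ Set.Icc (0 : ℝ) 1,
        (∑ i, α' i * circleContour α β t i) = exp (θ t) * (∑ i, β' i * circleContour α β t i)) ∧
      θ 1 - θ 0 = 2 * Real.pi * I := by
  -- m is a root of m² - Bm + AC = 0, which is what the factorization (u + (C/m)v)(Au + mv) of q
  -- requires.
  set m := (B + s) / 2 with hmdef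
  have hmm : m ^ 2 - B * m + A * C = 0 := by
    rw [hmdef]; linear_combination hs / 4
  have hsm : s = 2 * m - B := by rw [hmdef]; ring
  have hnorm : ∀ t : ℝ, ‖exp (2 * Real.pi * I * t)‖ = 1 := fun t => by
    rw [show 2 * Real.pi * I * t = ((2 * Real.pi * t : ℝ) : ℂ) * I by push_cast; ring]
    exact norm_exp_ofReal_mul_I _
  have hnorm' : ∀ t : ℝ, ‖exp (-(2 * Real.pi * I * t))‖ = 1 := fun t => by
    rw [exp_neg, norm_inv, hnorm, inv_one]
  have h1 : ∀ t : ℝ, 1 + C / m * exp (-(2 * Real.pi * I * t)) ∈ slitPlane := fun t =>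
    mem_slitPlane_of_norm_lt_one (by rwa [norm_mul, hnorm', mul_one])
  have h2 : ∀ t : ℝ, 1 + A / m * exp (2 * Real.pi * I * t) ∈ slitPlane := fun t =>
    mem_slitPlane_of_norm_lt_one (by rwa [norm_mul, hnorm, mul_one])
  have hq' : ∀ p, q p = (∑ i, (α + (C / m) • β) i * p i) * (∑ i, (A • α + m • β) i * p i) := by
    intro p
    simp only [hq, Fin.sum_univ_two, Pi.add_apply, Pi.smul_apply, smul_eq_mul]
    field_simp
    linear_combination (-(α 0 * p 0 + α 1 * p 1) * (β 0 * p 0 + β 1 * p 1)) * hmm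
  have e1 : ∀ t, ∑ i, (α + (C / m) • β) i * circleContour α β t i =
      exp (2 * Real.pi * I * t) * (1 + C / m * exp (-(2 * Real.pi * I * t))) := by
    intro t
    have a1 := circleContour_fst hD t
    have a2 := circleContour_snd hD t
    have a3 : exp (2 * Real.pi * I * t) * exp (-(2 * Real.pi * I * t)) = 1 := by
      rw [← exp_add]; simp
    simp only [Fin.sum_univ_two, Pi.add_apply, Pi.smul_apply, smul_eq_mul]
    linear_combination a1 + (C / m) * a2 - (C / m) * a3
  have e2 : ∀ t, ∑ i, (A • α + m • β) i * circleContour α β t i =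
      m * (1 + A / m * exp (2 * Real.pi * I * t)) := by
    intro t
    have a1 := circleContour_fst hD t
    have a2 := circleContour_snd hD t
    have a3 : m * (A / m) = A := by field_simp
    simp only [Fin.sum_univ_two, Pi.add_apply, Pi.smul_apply, smul_eq_mul]
    linear_combination A * a1 + m * a2 - exp (2 * Real.pi * I * t) * a3
  -- On the circle u = e^{2πit}, v = 1. The factors are e^{2πit} and m times quantities within
  -- distance less than 1 of 1, whose principal logarithms are single-valued, so all the winding
  -- comes from 2πit.
  refine ⟨α + (C / m) • β, A • α + m • β, ?_, hq', ?_,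
    fun t => 2 * Real.pi * I * t + log (1 + C / m * exp (-(2 * Real.pi * I * t)))
      - log (1 + A / m * exp (2 * Real.pi * I * t)) - log m, ?_, ?_, ?_⟩
  · simp only [Pi.add_apply, Pi.smul_apply, smul_eq_mul, hsm]
    field_simp
    linear_combination (-(α 0 * β 1 - α 1 * β 0)) * hmm
  · intro t _
    rw [hq', e1, e2]
    exact mul_ne_zero (mul_ne_zero (exp_ne_zero _) (slitPlane_ne_zero (h1 t)))
      (mul_ne_zero hm (slitPlane_ne_zero (h2 t)))
  · refine Continuous.continuousOn ?_
    refine ((Continuous.add (by fun_prop) ?_).sub ?_).sub continuous_const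
    · exact Continuous.clog (by fun_prop) h1
    · exact Continuous.clog (by fun_prop) h2
  · intro t _
    rw [e1, e2, exp_sub, exp_sub, exp_add, exp_log (slitPlane_ne_zero (h1 t)),
      exp_log (slitPlane_ne_zero (h2 t)), exp_log hm]
    have := slitPlane_ne_zero (h2 t)
    generalize 1 + A / m * exp (2 * Real.pi * I * t) = w at *
    field_simp
  · simp [exp_neg]

theorem continuous_chiOnLine (Q : Matrix TIdx TIdx ℂ) (p : Fin 2 → ℂ) :
    Continuous fun x => chiOnLine Q x p := by
  simp only [chiOnLine, chi, twistorOn, spinorForm, Fintype.sum_sum_type, Fin.sum_univ_two,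
    Sum.elim_inl, Sum.elim_inr, Matrix.smul_apply, Matrix.of_apply, Matrix.cons_val',
    Matrix.cons_val_zero, Matrix.cons_val_one, Matrix.cons_val_fin_one]
  fun_prop

/-- A continuous square root of the reciprocal of the discriminant is generated by the quadric,
with a suitable contour. -/
theorem exists_contour {X : Type*} [TopologicalSpace X] {τ : X → Pt ℂ} {x₀ : X}
    (hτ : ContinuousAt τ x₀) {a b c : Matrix (Fin 2) (Fin 2) ℂ} (ha : a.IsSymm) (hc : c.IsSymm)
    {f : X → ℂ} (hf : ContinuousAt f x₀)
    (hfx : ∀ᶠ x in 𝓝 x₀, f x ^ 2 * normSq₃ ((ckyOf a b c).eval (τ x)) = 1) :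
    ∃ γ : ℝ → Fin 2 → ℂ, ∀ᶠ x in 𝓝 x₀,
      IsSeparatingContour (chiOnLine (quadricOf a b c) (τ x)) γ ∧
        f x = scalarField (quadricOf a b c) γ (τ x) := by
  set Q := quadricOf a b c with hQ
  have hquad : ∀ x, ∃ A B C : ℂ, (∀ p, chiOnLine Q (τ x) p = A * p 0 ^ 2 + B * (p 0 * p 1)
      + C * p 1 ^ 2) ∧ B ^ 2 - 4 * A * C = normSq₃ ((ckyOf a b c).eval (τ x)) := by
    intro x
    refine ⟨(2 * I)⁻¹ * lineSpinor a b c (spinorForm (τ x)) 0 0,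
      I⁻¹ * lineSpinor a b c (spinorForm (τ x)) 0 1,
      (2 * I)⁻¹ * lineSpinor a b c (spinorForm (τ x)) 1 1,
      fun p => (chiOnLine_quadricOf ha hc (τ x) p).trans ?_, ?_⟩
    · field_simp
    · rw [eval_ckyOf ha, normSq₃_spinorVec (lineSpinor_isSymm ha hc _), Matrix.det_fin_two,
        (lineSpinor_isSymm ha hc _).apply 0 1]
      have hI : I ^ 2 = -1 := I_sq
      field_simp
      rw [hI]
      ring
  have hf0 := hfx.self_of_nhds
  have hfne : f x₀ ≠ 0 := by
    intro h; rw [h] at hf0; simp at hf0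
  obtain ⟨A₀, B₀, C₀, hq₀, hdisc⟩ := hquad x₀
  -- The sign of δ orders the two factors and so orients the contour: the residue -1/D must be f x₀.
  obtain ⟨α, β, hA₀, hB₀, hC₀, hδ⟩ := exists_linear_factors (A := A₀) (B := B₀) (C := C₀)
    (δ := -(f x₀)⁻¹) (by rw [hdisc]; field_simp; linear_combination -hf0)
  have hD : α 0 * β 1 - α 1 * β 0 ≠ 0 := by rw [hδ]; exact neg_ne_zero.2 (inv_ne_zero hfne)
  set D := α 0 * β 1 - α 1 * β 0 with hDdef
  -- The coefficients of χ in u², uv, v² are found by evaluating at the points where (u, v) is (D,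
  -- 0), (0, D) and (D, D).
  set A : X → ℂ := fun x => chiOnLine Q (τ x) ![β 1, -β 0] / D ^ 2 with hAdef
  set C : X → ℂ := fun x => chiOnLine Q (τ x) ![-α 1, α 0] / D ^ 2 with hCdef
  set B : X → ℂ := fun x => chiOnLine Q (τ x) ![β 1 - α 1, α 0 - β 0] / D ^ 2 - A x - C x
    with hBdef
  have hchi : ∀ p, ContinuousAt (fun x => chiOnLine Q (τ x) p) x₀ := fun p =>
    (continuous_chiOnLine Q p).continuousAt.comp hτ
  have hAc : ContinuousAt A x₀ := (hchi _).div_const _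
  have hCc : ContinuousAt C x₀ := (hchi _).div_const _
  have hBc : ContinuousAt B x₀ := (((hchi _).div_const _).sub hAc).sub hCc
  have hq : ∀ x p, chiOnLine Q (τ x) p = A x * (α 0 * p 0 + α 1 * p 1) ^ 2
      + B x * ((α 0 * p 0 + α 1 * p 1) * (β 0 * p 0 + β 1 * p 1))
      + C x * (β 0 * p 0 + β 1 * p 1) ^ 2 := by
    intro x p
    obtain ⟨A', B', C', h, -⟩ := hquad x
    simp only [hBdef, hAdef, hCdef, h, Matrix.cons_val_zero, Matrix.cons_val_one]
    field_simp
    rw [hDdef]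
    ring
  have hA0 : A x₀ = 0 := by
    simp only [hAdef, hq₀, Matrix.cons_val_zero, Matrix.cons_val_one]
    rw [← hA₀, ← hB₀, ← hC₀]
    field_simp
    ring
  have hC0 : C x₀ = 0 := by
    simp only [hCdef, hq₀, Matrix.cons_val_zero, Matrix.cons_val_one]
    rw [← hA₀, ← hB₀, ← hC₀]
    field_simp
    ring
  have hB0 : B x₀ = 1 := by
    simp only [hBdef, hA0, hC0, hq₀, Matrix.cons_val_zero, Matrix.cons_val_one]
    rw [← hA₀, ← hB₀, ← hC₀]
    field_simp
    rw [hDdef]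
    ring
  set r : X → ℂ := fun x => B x ^ 2 - 4 * A x * C x with hrdef
  have hrc : ContinuousAt r x₀ := by fun_prop
  have hr0 : r x₀ = 1 := by simp [hrdef, hA0, hB0]
  -- The branch of the root of the discriminant that equals 1 at x₀.
  set s : X → ℂ := fun x => exp (log (r x) / 2) with hsdef
  have hsc : ContinuousAt s x₀ := by
    have : ContinuousAt (fun x => log (r x)) x₀ :=
      hrc.clog (by rw [hr0]; exact one_mem_slitPlane)
    fun_prop
  have hs0 : s x₀ = 1 := by simp [hsdef, hr0]
  have hs2 : ∀ᶠ x in 𝓝 x₀, s x ^ 2 = B x ^ 2 - 4 * A x * C x := by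
    filter_upwards [hrc.eventually_ne (by rw [hr0]; exact one_ne_zero)] with x hx
    rw [hsdef, ← exp_nat_mul]
    push_cast
    rw [mul_div_cancel₀ _ two_ne_zero, exp_log hx]
  have hmc : ContinuousAt (fun x => (B x + s x) / 2) x₀ := by fun_prop
  have hm0 : (B x₀ + s x₀) / 2 = 1 := by rw [hB0, hs0]; norm_num
  have hm : ∀ᶠ x in 𝓝 x₀, (B x + s x) / 2 ≠ 0 :=
    hmc.eventually_ne (by rw [hm0]; exact one_ne_zero)
  have hCm : ∀ᶠ x in 𝓝 x₀, ‖C x / ((B x + s x) / 2)‖ < 1 :=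
    (hCc.div hmc (by rw [hm0]; exact one_ne_zero)).norm.eventually_lt_const (by simp [hC0])
  have hAm : ∀ᶠ x in 𝓝 x₀, ‖A x / ((B x + s x) / 2)‖ < 1 :=
    (hAc.div hmc (by rw [hm0]; exact one_ne_zero)).norm.eventually_lt_const (by simp [hA0])
  -- f·s·D has square 1 near x₀ and equals -1 at x₀, so by continuity it stays -1. This matches f
  -- with the residue -1/(sD).
  have hsgn : ∀ᶠ x in 𝓝 x₀, f x * (s x * D) ≠ 1 := by
    refine ContinuousAt.eventually_ne (by fun_prop) ?_
    rw [hs0, hδ]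
    field_simp
    norm_num
  refine ⟨circleContour α β, ?_⟩
  filter_upwards [hfx, hs2, hm, hCm, hAm, hsgn] with x h1 h2 h3 h4 h5 h6
  obtain ⟨α', β', hD', hq', hne, θ, hθ, hexp, hw⟩ := circleContour_perturb hD (hq x) h2 h3 h4 h5
  have hsep : IsSeparatingContour (chiOnLine Q (τ x)) (circleContour α β) :=
    ⟨(contDiff_circleContour α β).contDiffOn, circleContour_closed α β, hne, α', β', hq', θ, hθ,
      hexp, hw⟩
  refine ⟨hsep, ?_⟩
  obtain ⟨hD0, hS⟩ := scalarField_eq (contDiff_circleContour α β).contDiffOn hq' hne hθ hexp hw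
  have h7 := (separating_contour_fields ha hc hsep).1
  rw [← hQ, hS, hD'] at h7
  rw [hD'] at hD0
  rw [hS, hD']
  have h8 : (f x * (s x * D) - 1) * (f x * (s x * D) + 1) = 0 := by
    have hN : normSq₃ ((ckyOf a b c).eval (τ x)) = (s x * D) ^ 2 := by
      rw [neg_sq, inv_pow, inv_mul_eq_iff_eq_mul₀ (pow_ne_zero 2 hD0)] at h7
      rw [h7, mul_one]
    rw [hN] at h1
    linear_combination h1
  have h9 := (mul_eq_zero.1 h8).resolve_left (sub_ne_zero.2 h6)
  rw [← hDdef] at hD0 ⊢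
  apply mul_right_cancel₀ hD0
  rw [neg_mul, inv_mul_cancel₀ hD0]
  linear_combination h9

end Contours

/-! ### The Levi-Civita symbol and self-duality in components. -/

section LeviCivita

variable {𝕜 : Type*} [RCLike 𝕜]

/-- The sign of a permutation is its Vandermonde product divided by that of (0,1,2,3), which is 12.
The product vanishes when an index repeats. -/
theorem leviCivita_eq (a b c d : Fin 4) : leviCivita (𝕜 := 𝕜) a b c d =
    (((b : ℤ) - a) * (c - a) * (d - a) * (c - b) * (d - b) * (d - c) / 12 : ℤ) := by
  have h : ∀ a b c d : Fin 4, (Matrix.of fun i j : Fin 4 =>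
      if ![a, b, c, d] i = j then (1 : ℤ) else 0).det =
      (((b : ℤ) - a) * (c - a) * (d - a) * (c - b) * (d - b) * (d - c) / 12 : ℤ) := by
    decide +kernel
  rw [← h, leviCivita, Int.cast_det]
  congr 1
  ext i j
  simp

theorem hodge_apply (κ : Matrix (Fin 4) (Fin 4) 𝕜) (a b : Fin 4) :
    ∑ c, ∑ d, leviCivita a b c d * κ c d =
    (!![0, κ 2 3 - κ 3 2, κ 3 1 - κ 1 3, κ 1 2 - κ 2 1;
      κ 3 2 - κ 2 3, 0, κ 0 3 - κ 3 0, κ 2 0 - κ 0 2;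
      κ 1 3 - κ 3 1, κ 3 0 - κ 0 3, 0, κ 0 1 - κ 1 0;
      κ 2 1 - κ 1 2, κ 0 2 - κ 2 0, κ 1 0 - κ 0 1, 0] : Matrix (Fin 4) (Fin 4) 𝕜) a b := by
  simp only [leviCivita_eq, Fin.sum_univ_four]
  fin_cases a <;> fin_cases b <;> norm_num <;> ring

theorem selfDual_sdForm (v : Fin 3 → 𝕜) (a b : Fin 4) :
    (1 / 2) * ∑ c, ∑ d, leviCivita a b c d * sdForm v c d = sdForm v a b := by
  rw [hodge_apply]
  fin_cases a <;> fin_cases b <;> simp [sdForm] <;> ring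

theorem eq_sdForm_of_selfDual {κ : Matrix (Fin 4) (Fin 4) 𝕜} (hκ : ∀ a b, κ a b = -κ b a)
    (h : ∀ a b, (1 / 2) * ∑ c, ∑ d, leviCivita a b c d * κ c d = κ a b) :
    κ = sdForm ![κ 0 1, κ 0 2, κ 0 3] := by
  simp only [hodge_apply] at h
  have hd : ∀ a, κ a a = 0 := fun a => by
    have := hκ a a
    exact self_eq_neg.1 this
  have h23 : κ 2 3 = κ 0 1 := by
    have := h 2 3; simp [hκ 1 0] at this; linear_combination -this
  have h31 : κ 1 3 = -κ 0 2 := by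
    have := h 3 1; simp [hκ 2 0, hκ 3 1] at this; linear_combination this
  have h12 : κ 1 2 = κ 0 3 := by
    have := h 1 2; simp [hκ 3 0] at this; linear_combination -this
  ext a b
  fin_cases a <;> fin_cases b <;>
    simp [sdForm, hd, h23, h31, h12, hκ 1 0, hκ 2 0, hκ 3 0, hκ 2 1, hκ 3 1, hκ 3 2]

end LeviCivita

/-! ## Differential calculus -/

section Calculus

variable {𝕜 : Type*} [RCLike 𝕜] {f g : Pt 𝕜 → 𝕜} {x : Pt 𝕜} {U : Set (Pt 𝕜)}

theorem pd_congr (h : f =ᶠ[𝓝 x] g) (a : Fin 4) : pd f a x = pd g a x := by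
  rw [pd, pd, h.fderiv_eq]

theorem pd_congr_on (hU : IsOpen U) (hx : x ∈ U) (h : ∀ y ∈ U, f y = g y) (a : Fin 4) :
    pd f a x = pd g a x :=
  pd_congr (Filter.eventuallyEq_of_mem (hU.mem_nhds hx) h) a

theorem pd_const (c : 𝕜) (a : Fin 4) (x : Pt 𝕜) : pd (fun _ => c) a x = 0 := by
  simp [pd]

theorem pd_neg (f : Pt 𝕜 → 𝕜) (a : Fin 4) (x : Pt 𝕜) : pd (fun y => -f y) a x = -pd f a x := by
  simp [pd, fderiv_fun_neg]

theorem pd_add (hf : DifferentiableAt 𝕜 f x) (hg : DifferentiableAt 𝕜 g x) (a : Fin 4) :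
    pd (fun y => f y + g y) a x = pd f a x + pd g a x := by
  simp [pd, fderiv_fun_add hf hg]

theorem pd_sub (hf : DifferentiableAt 𝕜 f x) (hg : DifferentiableAt 𝕜 g x) (a : Fin 4) :
    pd (fun y => f y - g y) a x = pd f a x - pd g a x := by
  simp [pd, fderiv_fun_sub hf hg]

theorem pd_mul (hf : DifferentiableAt 𝕜 f x) (hg : DifferentiableAt 𝕜 g x) (a : Fin 4) :
    pd (fun y => f y * g y) a x = f x * pd g a x + g x * pd f a x := by
  simp [pd, fderiv_fun_mul hf hg]

theorem pd_sq (hf : DifferentiableAt 𝕜 f x) (a : Fin 4) :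
    pd (fun y => f y ^ 2) a x = 2 * f x * pd f a x := by
  simp only [pow_two]
  rw [pd_mul hf hf]; ring

theorem pd_inv (hf : DifferentiableAt 𝕜 f x) (hx : f x ≠ 0) (a : Fin 4) :
    pd (fun y => (f y)⁻¹) a x = -pd f a x / f x ^ 2 := by
  have h := (((hasDerivAt_inv hx).comp_hasFDerivAt x hf.hasFDerivAt)).fderiv
  have h' : fderiv 𝕜 (fun y => (f y)⁻¹) x = _ := h
  rw [pd, h']
  simp [pd]
  ring

theorem pd_sum {ι : Type*} (s : Finset ι) {f : ι → Pt 𝕜 → 𝕜}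
    (hf : ∀ i ∈ s, DifferentiableAt 𝕜 (f i) x) (a : Fin 4) :
    pd (fun y => ∑ i ∈ s, f i y) a x = ∑ i ∈ s, pd (f i) a x := by
  simp [pd, fderiv_fun_sum hf]

/-- The derivative of a function that is quadratic along a line. -/
theorem pd_eq_of_line (hf : DifferentiableAt 𝕜 f x) (a : Fin 4) (A B : 𝕜)
    (h : ∀ t, f (x + t • Pi.single a 1) = f x + t * A + t ^ 2 * B) : pd f a x = A := by
  rw [pd, ← hf.lineDeriv_eq_fderiv, lineDeriv]
  simp only [h]
  have h1 : HasDerivAt (fun t : 𝕜 => f x + t * A + t ^ 2 * B) (1 * A + 0) 0 := by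
    refine HasDerivAt.add ((((hasDerivAt_id (0 : 𝕜)).mul_const A)).const_add (f x)) ?_
    simpa using (hasDerivAt_pow 2 (0 : 𝕜)).mul_const B
  rw [h1.deriv]; simp

theorem contDiffOn_pd (hU : IsOpen U) (hf : ContDiffOn 𝕜 ∞ f U) (a : Fin 4) :
    ContDiffOn 𝕜 ∞ (pd f a) U :=
  (hf.fderiv_of_isOpen hU (m := ∞) (by simp)).clm_apply contDiffOn_const

theorem differentiableAt_of_smooth (hU : IsOpen U) (hf : ContDiffOn 𝕜 ∞ f U) (hx : x ∈ U) :
    DifferentiableAt 𝕜 f x :=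
  (hf.contDiffAt (hU.mem_nhds hx)).differentiableAt (by simp)

theorem pd_comm (hU : IsOpen U) (hf : ContDiffOn 𝕜 ∞ f U) (hx : x ∈ U) (a b : Fin 4) :
    pd (pd f a) b x = pd (pd f b) a x := by
  have hfx := hf.contDiffAt (hU.mem_nhds hx)
  have hsymm : IsSymmSndFDerivAt 𝕜 f x := hfx.isSymmSndFDerivAt (by
    rw [minSmoothness_of_isRCLikeNormedField]; exact ENat.LEInfty.out)
  have hd : DifferentiableAt 𝕜 (fderiv 𝕜 f) x :=
    (hfx.fderiv_right (m := 1) (WithTop.coe_le_coe.2 (le_top : (1 + 1 : ℕ∞) ≤ ⊤))).differentiableAt one_ne_zero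
  have key : ∀ a b : Fin 4, pd (pd f a) b x =
      fderiv 𝕜 (fderiv 𝕜 f) x (Pi.single b 1) (Pi.single a 1) := by
    intro a b
    have : pd f a = fun y => fderiv 𝕜 f y (Pi.single a 1) := rfl
    rw [this, pd, fderiv_clm_apply hd (differentiableAt_const _)]
    simp
  rw [key, key]
  exact hsymm _ _

theorem eq_const_of_pd_eq_zero (hU : IsOpen U) (hUc : IsPreconnected U)
    (hf : DifferentiableOn 𝕜 f U) (h : ∀ x ∈ U, ∀ a, pd f a x = 0) : ∃ c, ∀ x ∈ U, f x = c := by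
  refine hU.exists_is_const_of_fderiv_eq_zero hUc hf fun x hx => ?_
  have : (fderiv 𝕜 f x : Pt 𝕜 →ₗ[𝕜] 𝕜) = 0 := by
    refine LinearMap.pi_ext' fun a => LinearMap.ext_ring ?_
    simpa [pd] using h x hx a
  exact ContinuousLinearMap.coe_injective this

end Calculus

/-! ## Parallel complex structures -/

section KahlerAlgebra

variable {R : Type*} [CommRing R]

/-- The derivative of the components of a self-dual complex structure that is parallel for the
conformally rescaled metric, `w` being the logarithmic derivative of the conformal factor. -/
def parallelPart (j : Fin 3 → R) (w : Fin 4 → R) (a : Fin 4) : Fin 3 → R :=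
  w a • j + sdPair (Pi.single a 1) ((sdForm j).mulVec w)

/-- The Nijenhuis tensor of a self-dual almost complex structure with derivative `p`. -/
def sdNijenhuis (j : Fin 3 → R) (p : Fin 4 → Fin 3 → R) (c a b : Fin 4) : R :=
  ∑ d, (sdForm j d a * sdForm (p d) c b - sdForm j d b * sdForm (p d) c a
    - sdForm j c d * (sdForm (p a) d b - sdForm (p b) d a))

theorem sdForm_sub (v w : Fin 3 → R) : sdForm (v - w) = sdForm v - sdForm w := by
  ext i j
  fin_cases i <;> fin_cases j <;> simp [sdForm] <;> ring

theorem sdForm_antisymm (v : Fin 3 → R) (a b : Fin 4) : sdForm v a b = -sdForm v b a := by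
  fin_cases a <;> fin_cases b <;> simp [sdForm]

theorem sdPair_single (a : Fin 4) (y : Fin 4 → R) : sdPair (Pi.single a 1) y =
    (![![y 1, y 2, y 3], ![-y 0, -y 3, y 2], ![y 3, -y 0, -y 1], ![-y 2, y 1, -y 0]] :
      Fin 4 → Fin 3 → R) a := by
  ext i
  fin_cases a <;> fin_cases i <;> simp [sdPair]

theorem sdForm_mulVec (v : Fin 3 → R) (y : Fin 4 → R) : (sdForm v).mulVec y =
    ![v 0 * y 1 + v 1 * y 2 + v 2 * y 3, -v 0 * y 0 + v 2 * y 2 - v 1 * y 3,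
      -v 1 * y 0 - v 2 * y 1 + v 0 * y 3, -v 2 * y 0 + v 1 * y 1 - v 0 * y 2] := by
  ext i
  fin_cases i <;> simp [sdForm, dotProduct, Fin.sum_univ_four] <;> ring

-- A torsion-free connection preserving J makes it integrable. With `cyclic_parallelPart`, its
-- counterpart for closedness, this is the easy direction, and it holds for any length of j.
set_option maxHeartbeats 2000000 in
theorem sdNijenhuis_parallelPart (j : Fin 3 → R) (w : Fin 4 → R) (c a b : Fin 4) :
    sdNijenhuis j (parallelPart j w) c a b = 0 := by
  simp only [sdNijenhuis, parallelPart, sdPair_single, sdForm_mulVec, Fin.sum_univ_four]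
  fin_cases c <;> fin_cases a <;> fin_cases b <;> simp [sdForm] <;> ring

set_option maxHeartbeats 2000000 in
theorem cyclic_parallelPart (j : Fin 3 → R) (w : Fin 4 → R) (a b c : Fin 4) :
    2 * (w a * sdForm j b c + w b * sdForm j c a + w c * sdForm j a b)
      + (sdForm (parallelPart j w a) b c + sdForm (parallelPart j w b) c a
        + sdForm (parallelPart j w c) a b) = 0 := by
  simp only [parallelPart, sdPair_single, sdForm_mulVec]
  fin_cases c <;> fin_cases a <;> fin_cases b <;> simp [sdForm] <;> ring

/-- The classical argument that dω = 0 and N = 0 force ∇J = 0, with P as ∇J. For T = J·P in the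
first index, the cyclic identity turns N = 0 into a three-term relation. Adding two of its
permutations gives 2T = 0, and a second application of J gives P = 0. -/
theorem eq_zero_of_cyclic_of_nijenhuis {K n : Type*} [Field K] [CharZero K] [Fintype n]
    [DecidableEq n] {J : Matrix n n K} (hJ : ∀ a b, J a b = -J b a) (hJJ : J * J = -1)
    {P : n → n → n → K} (hanti : ∀ a b c, P a b c = -P a c b)
    (hcyc : ∀ a b c, P a b c + P b c a + P c a b = 0)
    (hN : ∀ c a b, ∑ d, (J d a * P d c b - J d b * P d c a - J c d * (P a d b - P b d a)) = 0)
    (a b c : n) : P a b c = 0 := by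
  set T : n → n → n → K := fun a c b => ∑ d, J d a * P d c b with hT
  have hTanti : ∀ a b c, T a b c = -T a c b := by
    intro a b c
    simp only [hT, ← Finset.sum_neg_distrib]
    exact Finset.sum_congr rfl fun d _ => by rw [hanti d b c]; ring
  have h1 : ∀ c a b, T a c b - T b c a + T c a b = 0 := by
    intro c a b
    rw [← hN c a b, Finset.sum_sub_distrib, Finset.sum_sub_distrib]
    simp only [hT, sub_eq_add_neg, ← Finset.sum_neg_distrib]
    congr 1
    refine Finset.sum_congr rfl fun d _ => ?_
    rw [hJ c d]
    linear_combination (-J d c) * hcyc a d b + J d c * hanti d a b + J d c * hanti b a d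
  have hT0 : ∀ b c a, T b c a = 0 := by
    intro b c a
    have e1 := h1 c a b
    have e2 := h1 a b c
    rw [hTanti a c b] at e1
    rw [hTanti b a c] at e2
    have : (2 : K) * T b c a = 0 := by linear_combination -e1 - e2
    exact (mul_eq_zero.1 this).resolve_left two_ne_zero
  have key : ∑ e, J e a * T e b c = ∑ d, (J * J) d a * P d b c := by
    simp only [hT, Matrix.mul_apply, Finset.mul_sum, Finset.sum_mul]
    rw [Finset.sum_comm]
    exact Finset.sum_congr rfl fun d _ => Finset.sum_congr rfl fun e _ => by ring
  simp only [hT0, mul_zero, Finset.sum_const_zero, hJJ, Matrix.neg_apply, Matrix.one_apply,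
    neg_mul, ite_mul, one_mul, zero_mul, Finset.sum_neg_distrib, Finset.sum_ite_eq',
    Finset.mem_univ, if_true] at key
  simpa using key.symm

/-- A closed self-dual almost complex structure without torsion is parallel. -/
theorem eq_parallelPart {K : Type*} [Field K] [CharZero K] {j : Fin 3 → K} {w : Fin 4 → K}
    {p : Fin 4 → Fin 3 → K} (hj : normSq₃ j = 1) (hN : ∀ c a b, sdNijenhuis j p c a b = 0)
    (hcyc : ∀ a b c, 2 * (w a * sdForm j b c + w b * sdForm j c a + w c * sdForm j a b)
      + (sdForm (p a) b c + sdForm (p b) c a + sdForm (p c) a b) = 0) (a : Fin 4) :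
    p a = parallelPart j w a := by
  -- Both conditions are affine in p and hold for `parallelPart`, so the difference satisfies the
  -- homogeneous conditions.
  have h0 := eq_zero_of_cyclic_of_nijenhuis (J := sdForm j)
    (P := fun a b c => sdForm (p a - parallelPart j w a) b c) (sdForm_antisymm j)
    (by rw [sdForm_mul_self, hj]; simp) (fun a b c => sdForm_antisymm _ b c)
    (fun a b c => by
      simp only [sdForm_sub, Matrix.sub_apply]
      linear_combination hcyc a b c - cyclic_parallelPart j w a b c)
    (fun c a b => by
      have h1 := hN c a b
      have h2 := sdNijenhuis_parallelPart j w c a b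
      simp only [sdNijenhuis] at h1 h2
      rw [← sub_zero (0 : K)]
      nth_rewrite 1 [← h1]
      rw [← h2, ← Finset.sum_sub_distrib]
      refine Finset.sum_congr rfl fun d _ => ?_
      simp only [sdForm_sub, Matrix.sub_apply]
      ring)
  ext i
  rw [← sub_eq_zero]
  fin_cases i
  · simpa [sdForm] using h0 a 0 1
  · simpa [sdForm] using h0 a 0 2
  · simpa [sdForm] using h0 a 0 3

end KahlerAlgebra

section Kahler

variable {𝕜 : Type*} [RCLike 𝕜] {x : Pt 𝕜} {U : Set (Pt 𝕜)} {Ω : Pt 𝕜 → 𝕜}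
  {j : Pt 𝕜 → Fin 3 → 𝕜} {κ : Pt 𝕜 → Matrix (Fin 4) (Fin 4) 𝕜}

theorem differentiableAt_sdForm {v : Pt 𝕜 → Fin 3 → 𝕜}
    (hv : ∀ i, DifferentiableAt 𝕜 (fun y => v y i) x) (b c : Fin 4) :
    DifferentiableAt 𝕜 (fun y => sdForm (v y) b c) x := by
  fin_cases b <;> fin_cases c <;> simp [sdForm] <;> first | exact hv _

theorem contDiffOn_sdForm {v : Pt 𝕜 → Fin 3 → 𝕜}
    (hv : ∀ i, ContDiffOn 𝕜 ∞ (fun y => v y i) U) (b c : Fin 4) :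
    ContDiffOn 𝕜 ∞ (fun y => sdForm (v y) b c) U := by
  fin_cases b <;> fin_cases c <;> simp [sdForm] <;>
    first
    | exact contDiffOn_const
    | exact hv _
    | exact (hv _).neg

theorem pd_sdForm {v : Pt 𝕜 → Fin 3 → 𝕜} (b c a : Fin 4) :
    pd (fun y => sdForm (v y) b c) a x = sdForm (fun i => pd (fun y => v y i) a x) b c := by
  fin_cases b <;> fin_cases c <;> simp [sdForm, pd_const, pd_neg]

theorem nijenhuis_eq {J : Pt 𝕜 → Matrix (Fin 4) (Fin 4) 𝕜} (hU : IsOpen U) (hx : x ∈ U)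
    (hJ : ∀ y ∈ U, J y = -sdForm (j y)) (c a b : Fin 4) :
    nijenhuis J c a b x = sdNijenhuis (j x) (fun a i => pd (fun y => j y i) a x) c a b := by
  have h : ∀ d e f, pd (fun y => J y d e) f x
      = -sdForm (fun i => pd (fun y => j y i) f x) d e := by
    intro d e f
    rw [pd_congr_on (g := fun y => -sdForm (j y) d e) hU hx (fun y hy => by rw [hJ y hy]; rfl),
      pd_neg, pd_sdForm]
  simp only [nijenhuis, sdNijenhuis, h, hJ x hx, Matrix.neg_apply]
  exact Finset.sum_congr rfl fun d _ => by ring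

theorem closed_eq (hU : IsOpen U) (hx : x ∈ U) (hΩ : DifferentiableAt 𝕜 Ω x) (hΩ0 : Ω x ≠ 0)
    (hj : ∀ i, DifferentiableAt 𝕜 (fun y => j y i) x)
    (hκ : ∀ y ∈ U, κ y = Ω y ^ 2 • sdForm (j y)) (a b c : Fin 4) :
    pd (fun y => κ y b c) a x + pd (fun y => κ y c a) b x + pd (fun y => κ y a b) c x =
    Ω x ^ 2 * (2 * (pd Ω a x / Ω x * sdForm (j x) b c + pd Ω b x / Ω x * sdForm (j x) c a
        + pd Ω c x / Ω x * sdForm (j x) a b)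
      + (sdForm (fun i => pd (fun y => j y i) a x) b c
        + sdForm (fun i => pd (fun y => j y i) b x) c a
        + sdForm (fun i => pd (fun y => j y i) c x) a b)) := by
  have h : ∀ d e f, pd (fun y => κ y d e) f x = Ω x ^ 2 * (2 * (pd Ω f x / Ω x) * sdForm (j x) d e
      + sdForm (fun i => pd (fun y => j y i) f x) d e) := by
    intro d e f
    rw [pd_congr_on (g := fun y => Ω y ^ 2 * sdForm (j y) d e) hU hx
      (fun y hy => by rw [hκ y hy]; rfl),
      pd_mul (f := fun y => Ω y ^ 2) (hΩ.pow 2) (differentiableAt_sdForm hj d e), pd_sq hΩ, pd_sdForm]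
    field_simp
    ring
  rw [h, h, h]
  ring

/-- A parallel self-dual complex structure is Kähler. -/
theorem isConformallyFlatKahler_of_parallel (hU : IsOpen U) (hΩ : ContDiffOn 𝕜 ∞ Ω U)
    (hΩ0 : ∀ x ∈ U, Ω x ≠ 0) (hj : ∀ i, ContDiffOn 𝕜 ∞ (fun y => j y i) U)
    (hj1 : ∀ x ∈ U, normSq₃ (j x) = 1)
    (hpar : ∀ x ∈ U, ∀ a, (fun i => pd (fun y => j y i) a x) =
      parallelPart (j x) (fun b => pd Ω b x / Ω x) a)
    (hκ : ∀ y ∈ U, κ y = Ω y ^ 2 • sdForm (j y)) : IsConformallyFlatKahler U Ω κ := by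
  refine ⟨hΩ, hΩ0, ⟨?_, ?_, fun y => -sdForm (j y), ?_, ?_, ?_, ?_, ?_, ?_⟩, ?_⟩
  · intro a b
    simp only [conformalMetric, Matrix.smul_apply, smul_eq_mul]
    exact (hΩ.pow 2).mul contDiffOn_const
  · intro x hx
    refine ⟨by simp [conformalMetric, Matrix.IsSymm], ?_⟩
    simp [conformalMetric, hΩ0 x hx]
  · intro a b
    exact (contDiffOn_sdForm hj a b).neg
  · intro x hx
    rw [neg_mul_neg, sdForm_mul_self, hj1 x hx]
    simp
  · intro x hx
    rw [Matrix.transpose_neg, sdForm_transpose, neg_neg, conformalMetric, Matrix.mul_smul,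
      Matrix.mul_one, Matrix.smul_mul, mul_neg, sdForm_mul_self, hj1 x hx]
    simp
  · intro x hx c a b
    rw [nijenhuis_eq hU hx (fun y _ => rfl)]
    have : (fun a i => pd (fun y => j y i) a x) =
        parallelPart (j x) (fun b => pd Ω b x / Ω x) := funext (hpar x hx)
    rw [this, sdNijenhuis_parallelPart]
  · intro x hx a b
    rw [hκ x hx]
    simp [conformalMetric, Matrix.one_apply, sdForm_antisymm (j x) a b]
  · intro x hx a b c
    rw [closed_eq hU hx (differentiableAt_of_smooth hU hΩ hx) (hΩ0 x hx)
      (fun i => differentiableAt_of_smooth hU (hj i) hx) hκ, hpar x hx, hpar x hx, hpar x hx]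
    exact mul_eq_zero_of_right _ (cyclic_parallelPart (j x) (fun b => pd Ω b x / Ω x) a b c)
  · intro x hx a b
    rw [hκ x hx, ← sdForm_smul]
    exact selfDual_sdForm _ a b

/-- The complex structure of a conformally flat Kähler structure is parallel. -/
theorem IsConformallyFlatKahler.exists_parallel (hU : IsOpen U)
    (h : IsConformallyFlatKahler U Ω κ) :
    ∃ j : Pt 𝕜 → Fin 3 → 𝕜, (∀ i, ContDiffOn 𝕜 ∞ (fun y => j y i) U) ∧
      (∀ x ∈ U, normSq₃ (j x) = 1) ∧
      (∀ x ∈ U, ∀ a, (fun i => pd (fun y => j y i) a x) =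
        parallelPart (j x) (fun b => pd Ω b x / Ω x) a) ∧
      ∀ y ∈ U, κ y = Ω y ^ 2 • sdForm (j y) := by
  obtain ⟨hΩ, hΩ0, ⟨-, -, J, hJs, hJJ, hJg, hJN, hκJ, hκd⟩, hsd⟩ := h
  have hJt : ∀ x ∈ U, (J x).transpose = -J x := by
    intro x hx
    have h1 := hJg x hx
    rw [conformalMetric, Matrix.mul_smul, Matrix.mul_one, Matrix.smul_mul] at h1
    have h2 : (J x).transpose * J x = 1 := smul_right_injective _ (pow_ne_zero 2 (hΩ0 x hx)) h1
    calc (J x).transpose = (J x).transpose * (J x * -J x) := by rw [mul_neg, hJJ x hx]; simp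
      _ = -J x := by rw [← mul_assoc, h2, one_mul]
  have hJa : ∀ x ∈ U, ∀ a b, J x a b = -J x b a := fun x hx a b => by
    have := congrFun (congrFun (hJt x hx) b) a
    simpa using this
  have hκ' : ∀ x ∈ U, ∀ a b, κ x a b = Ω x ^ 2 * J x b a := by
    intro x hx a b
    rw [hκJ x hx]
    simp [conformalMetric, Matrix.one_apply]
  -- κ_{ab} = Ω² J_{ba} has transposed indices, so j is read from a column and J = -`sdForm` j.
  set j : Pt 𝕜 → Fin 3 → 𝕜 := fun y => ![J y 1 0, J y 2 0, J y 3 0] with hjdef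
  have hκj : ∀ y ∈ U, κ y = Ω y ^ 2 • sdForm (j y) := by
    intro y hy
    rw [eq_sdForm_of_selfDual (κ := κ y) (fun a b => ?_) (hsd y hy), ← sdForm_smul]
    · congr 1
      ext i
      fin_cases i <;> simp [hκ' y hy, hjdef]
    · rw [hκ' y hy, hκ' y hy, hJa y hy]; ring
  have hJj : ∀ y ∈ U, J y = -sdForm (j y) := by
    intro y hy
    have h0 := pow_ne_zero 2 (hΩ0 y hy)
    ext a b
    have h1 := hκ' y hy b a
    rw [hκj y hy, Matrix.smul_apply, smul_eq_mul] at h1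
    rw [Matrix.neg_apply, ← sdForm_antisymm]
    exact (mul_left_cancel₀ h0 h1).symm
  have hj1 : ∀ x ∈ U, normSq₃ (j x) = 1 := by
    intro x hx
    have h1 := hJJ x hx
    rw [hJj x hx, neg_mul_neg, sdForm_mul_self] at h1
    have := congrFun (congrFun h1 0) 0
    simpa using this
  have hjs : ∀ i, ContDiffOn 𝕜 ∞ (fun y => j y i) U := by
    intro i
    fin_cases i
    · exact hJs 1 0
    · exact hJs 2 0
    · exact hJs 3 0
  refine ⟨j, hjs, hj1, fun x hx a => ?_, hκj⟩
  refine eq_parallelPart (p := fun a i => pd (fun y => j y i) a x) (hj1 x hx)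
    (fun c a b => ?_) (fun a b c => ?_) a
  · rw [← nijenhuis_eq hU hx hJj]
    exact hJN x hx c a b
  · have := hκd x hx a b c
    rw [closed_eq hU hx (differentiableAt_of_smooth hU hΩ hx) (hΩ0 x hx)
      (fun i => differentiableAt_of_smooth hU (hjs i) hx) hκj] at this
    exact (mul_eq_zero.1 this).resolve_left (pow_ne_zero 2 (hΩ0 x hx))

end Kahler

/-! ## Conformal Killing-Yano forms -/

section KillingYano

variable {𝕜 : Type*} [RCLike 𝕜] {x : Pt 𝕜} {U : Set (Pt 𝕜)} {Ω : Pt 𝕜 → 𝕜}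
  {κ : Pt 𝕜 → Matrix (Fin 4) (Fin 4) 𝕜}

namespace CKY

theorem contDiff_eval (P : CKY 𝕜) (i : Fin 3) : ContDiff 𝕜 ∞ (fun y : Pt 𝕜 => P.eval y i) := by
  simp only [eval_apply]
  fin_cases i <;> simp <;> fun_prop

theorem contDiff_xi (P : CKY 𝕜) (i : Fin 4) : ContDiff 𝕜 ∞ (fun y : Pt 𝕜 => P.xi y i) := by
  simp only [xi_apply]
  fin_cases i <;> simp <;> fun_prop

theorem differentiableAt_eval (P : CKY 𝕜) (i : Fin 3) :
    DifferentiableAt 𝕜 (fun y : Pt 𝕜 => P.eval y i) x :=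
  (P.contDiff_eval i).contDiffAt.differentiableAt (by simp)

theorem differentiableAt_xi (P : CKY 𝕜) (i : Fin 4) :
    DifferentiableAt 𝕜 (fun y : Pt 𝕜 => P.xi y i) x :=
  (P.contDiff_xi i).contDiffAt.differentiableAt (by simp)

theorem pd_eval (P : CKY 𝕜) (i : Fin 3) (a : Fin 4) (x : Pt 𝕜) :
    pd (fun y => P.eval y i) a x = sdPair (Pi.single a 1) (P.xi x) i := by
  -- For A anti-self-dual, `sdPair` x (A y) is symmetric in x and y, as A commutes with self-dual
  -- forms. This produces the 2 in `xi`.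
  refine pd_eq_of_line (P.differentiableAt_eval i) a _
    (sdPair (Pi.single a 1) ((asdForm P.α).mulVec (Pi.single a 1)) i) fun t => ?_
  rw [sdPair_single, sdPair_single]
  simp only [eval_apply, xi_apply]
  fin_cases i <;> fin_cases a <;> simp [asdForm] <;> ring

theorem pd_xi (P : CKY 𝕜) (b c : Fin 4) (x : Pt 𝕜) :
    pd (fun y => P.xi y b) c x = 2 * asdForm P.α b c := by
  refine pd_eq_of_line (P.differentiableAt_xi b) c _ 0 fun t => ?_
  simp only [xi_apply]
  fin_cases b <;> fin_cases c <;> simp [asdForm] <;> ring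

theorem pd_normSq (P : CKY 𝕜) (a : Fin 4) (x : Pt 𝕜) :
    pd (fun y => normSq₃ (P.eval y)) a x = 2 * (sdForm (P.eval x)).mulVec (P.xi x) a := by
  have h := P.differentiableAt_eval (x := x)
  have hs : ∀ i, DifferentiableAt 𝕜 (fun y : Pt 𝕜 => P.eval y i ^ 2) x := fun i => (h i).pow 2
  simp only [normSq₃]
  rw [pd_add ((hs 0).fun_add (hs 1)) (hs 2), pd_add (hs 0) (hs 1),
    pd_sq (h 0), pd_sq (h 1), pd_sq (h 2), pd_eval, pd_eval, pd_eval, sdPair_single, sdForm_mulVec]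
  fin_cases a <;> simp <;> ring

end CKY

/-- A conformal factor determined by a conformal Killing-Yano form. -/
theorem pd_conformalFactor (P : CKY 𝕜) (hU : IsOpen U) (hΩ : ContDiffOn 𝕜 ∞ Ω U)
    (hN : ∀ x ∈ U, Ω x ^ 2 * normSq₃ (P.eval x) = 1) (hx : x ∈ U) (a : Fin 4) :
    pd Ω a x = -Ω x ^ 3 * (sdForm (P.eval x)).mulVec (P.xi x) a := by
  have hd := differentiableAt_of_smooth hU hΩ hx
  have h0 : Ω x ≠ 0 := fun h => by simpa [h] using hN x hx
  have hNd : DifferentiableAt 𝕜 (fun y : Pt 𝕜 => normSq₃ (P.eval y)) x := by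
    have h := P.differentiableAt_eval (x := x)
    exact (((h 0).pow 2).add ((h 1).pow 2)).add ((h 2).pow 2)
  have h1 : pd (fun y => Ω y ^ 2 * normSq₃ (P.eval y)) a x = 0 := by
    rw [pd_congr_on (g := fun _ => 1) hU hx hN, pd_const]
  rw [pd_mul (f := fun y => Ω y ^ 2) (hd.pow 2) hNd, pd_sq hd, P.pd_normSq] at h1
  have h2 : Ω x * (2 * normSq₃ (P.eval x) * pd Ω a x
      + 2 * Ω x * (sdForm (P.eval x)).mulVec (P.xi x) a) = 0 := by
    linear_combination h1
  have h3 := (mul_eq_zero.1 h2).resolve_left h0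
  have h4 := hN x hx
  linear_combination (Ω x ^ 2 / 2) * h3 - pd Ω a x * h4

/-- A conformal Killing-Yano form defines a conformally flat Kähler structure. -/
theorem isConformallyFlatKahler_of_cky (P : CKY 𝕜) (hU : IsOpen U) (hΩ : ContDiffOn 𝕜 ∞ Ω U)
    (hN : ∀ x ∈ U, Ω x ^ 2 * normSq₃ (P.eval x) = 1)
    (hκ : ∀ x ∈ U, κ x = Ω x ^ 3 • sdForm (P.eval x)) : IsConformallyFlatKahler U Ω κ := by
  have hΩ0 : ∀ x ∈ U, Ω x ≠ 0 := fun x hx h => by simpa [h] using hN x hx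
  refine isConformallyFlatKahler_of_parallel (j := fun y => Ω y • P.eval y) hU hΩ hΩ0
    (fun i => hΩ.mul (P.contDiff_eval i).contDiffOn) (fun x hx => ?_) (fun x hx a => ?_)
    (fun x hx => ?_)
  · rw [← hN x hx]
    simp only [normSq₃, Pi.smul_apply, smul_eq_mul]
    ring
  · have h0 := hΩ0 x hx
    have hd := differentiableAt_of_smooth hU hΩ hx
    -- dΩ = -Ω³F(k)ξ with F(k)² = -|k|² and Ω²|k|² = 1, so F(k) recovers ξ from dΩ.
    have hF : (sdForm (P.eval x)).mulVec (fun b => pd Ω b x) = Ω x • P.xi x := by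
      have : (fun b => pd Ω b x) = (-Ω x ^ 3) • (sdForm (P.eval x)).mulVec (P.xi x) :=
        funext fun b => pd_conformalFactor P hU hΩ hN hx b
      rw [this, Matrix.mulVec_smul, Matrix.mulVec_mulVec, sdForm_mul_self, Matrix.smul_mulVec,
        Matrix.one_mulVec, smul_smul]
      congr 1
      linear_combination Ω x * hN x hx
    have hw : (fun b => pd Ω b x / Ω x) = (Ω x)⁻¹ • fun b => pd Ω b x := by
      ext b; simp [div_eq_inv_mul]
    rw [parallelPart, hw, sdForm_smul, Matrix.smul_mulVec, Matrix.mulVec_smul, hF, smul_smul, smul_smul,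
      mul_inv_cancel₀ h0, one_smul]
    ext i
    simp only [Pi.smul_apply, smul_eq_mul, Pi.add_apply]
    rw [pd_mul hd (P.differentiableAt_eval i), P.pd_eval]
    have : sdPair (Pi.single a 1) (Ω x • P.xi x) i = Ω x * sdPair (Pi.single a 1) (P.xi x) i := by
      rw [sdPair_single, sdPair_single]
      fin_cases a <;> fin_cases i <;> simp
    rw [this]
    field_simp
    ring
  · rw [hκ x hx, sdForm_smul, smul_smul]
    congr 1
    ring

/-- Integration of the conformal Killing-Yano equation. -/
theorem exists_cky_eq (hU : IsOpen U) (hUc : IsPreconnected U) {k : Pt 𝕜 → Fin 3 → 𝕜}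
    {ξ : Pt 𝕜 → Fin 4 → 𝕜} (hk : ∀ i, ContDiffOn 𝕜 ∞ (fun y => k y i) U)
    (hξ : ∀ b, ContDiffOn 𝕜 ∞ (fun y => ξ y b) U)
    (h : ∀ x ∈ U, ∀ a i, pd (fun y => k y i) a x = sdPair (Pi.single a 1) (ξ x) i) :
    ∃ P : CKY 𝕜, ∀ x ∈ U, k x = P.eval x := by
  set M : Fin 4 → Fin 4 → Pt 𝕜 → 𝕜 := fun c b => pd (fun y => ξ y b) c with hM
  have hξd : ∀ x ∈ U, ∀ b, DifferentiableAt 𝕜 (fun y => ξ y b) x := fun x hx b =>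
    differentiableAt_of_smooth hU (hξ b) hx
  -- The integrability condition ∂_c∂_a k = ∂_a∂_c k.
  have hsymm : ∀ x ∈ U, ∀ a c i, sdPair (Pi.single a 1) (fun b => M c b x) i
      = sdPair (Pi.single c 1) (fun b => M a b x) i := by
    have key : ∀ x ∈ U, ∀ a c i, pd (pd (fun y => k y i) a) c x =
        sdPair (Pi.single a 1) (fun b => M c b x) i := by
      intro x hx a c i
      rw [pd_congr_on hU hx (fun y hy => h y hy a i)]
      simp only [sdPair_single]
      fin_cases a <;> fin_cases i <;> simp [pd_neg, hM]
    intro x hx a c i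
    rw [← key x hx, ← key x hx, pd_comm hU (hk i) hx]
  simp only [sdPair_single] at hsymm
  -- Its solution: the matrix ∂_c ξ_b is antisymmetric and anti-self-dual.
  have hMx : ∀ x ∈ U, M 0 0 x = 0 ∧ M 1 1 x = 0 ∧ M 2 2 x = 0 ∧ M 3 3 x = 0 ∧
      M 0 1 x = -M 1 0 x ∧ M 0 2 x = -M 2 0 x ∧ M 0 3 x = -M 3 0 x ∧
      M 2 1 x = -M 3 0 x ∧ M 3 1 x = M 2 0 x ∧ M 1 2 x = M 3 0 x ∧ M 3 2 x = -M 1 0 x ∧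
      M 1 3 x = -M 2 0 x ∧ M 2 3 x = M 1 0 x := by
    intro x hx
    have s := hsymm x hx
    have a1 := s 0 1 0
    have a2 := s 0 1 1
    have a3 := s 0 1 2
    have b1 := s 0 2 0
    have b2 := s 0 2 1
    have b3 := s 0 2 2
    have c1 := s 0 3 0
    have c2 := s 0 3 1
    have c3 := s 0 3 2
    have d1 := s 1 2 0
    have d2 := s 1 2 1
    have d3 := s 1 2 2
    have e1 := s 1 3 0
    simp at a1 a2 a3 b1 b2 b3 c1 c2 c3 d1 d2 d3 e1
    have z : M 1 1 x = 0 := by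
      have : (2 : 𝕜) * M 1 1 x = 0 := by linear_combination a1 - b2 + d3
      exact (mul_eq_zero.1 this).resolve_left two_ne_zero
    exact ⟨by linear_combination a1 - z, z, by linear_combination d3 - z,
      by linear_combination c3 - a1 + z, by linear_combination b3 - d2,
      by linear_combination -d1 - a3, by linear_combination a2 + e1,
      by linear_combination b1 + a2 + e1, by linear_combination c1 + d1 + a3,
      by linear_combination -e1, by linear_combination c2 + b3 - d2, by linear_combination -d1,
      d2⟩
  have hMs : ∀ c b, ContDiffOn 𝕜 ∞ (M c b) U := fun c b => contDiffOn_pd hU (hξ b) c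
  -- ∂_b∂_c ξ_b = ∂_c(∂_b ξ_b), and the diagonal of M vanishes.
  have hMz : ∀ x ∈ U, ∀ b c, pd (M c b) b x = 0 := by
    intro x hx b c
    have h0 : ∀ y ∈ U, M b b y = 0 := by
      intro y hy
      obtain ⟨h0, h1, h2, h3, -⟩ := hMx y hy
      fin_cases b
      exacts [h0, h1, h2, h3]
    rw [hM]
    simp only
    rw [pd_comm hU (hξ b) hx, pd_congr_on (g := fun _ => 0) hU hx h0, pd_const]
  have hneg : ∀ {f g : Pt 𝕜 → 𝕜} {x : Pt 𝕜} {a : Fin 4}, x ∈ U → (∀ y ∈ U, f y = -g y) →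
      pd f a x = 0 → pd g a x = 0 := by
    intro f g x a hx hfg hf
    rw [pd_congr_on (g := fun y => -g y) hU hx hfg, pd_neg] at hf
    exact neg_eq_zero.1 hf
  have hpos : ∀ {f g : Pt 𝕜 → 𝕜} {x : Pt 𝕜} {a : Fin 4}, x ∈ U → (∀ y ∈ U, f y = g y) →
      pd f a x = 0 → pd g a x = 0 := by
    intro f g x a hx hfg hf
    rwa [← pd_congr_on hU hx hfg]
  have hconst : ∀ {f : Pt 𝕜 → 𝕜}, ContDiffOn 𝕜 ∞ f U → (∀ x ∈ U, ∀ a, pd f a x = 0) →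
      ∃ c, ∀ x ∈ U, f x = c := fun hf h0 =>
    eq_const_of_pd_eq_zero hU hUc (hf.differentiableOn (by simp)) h0
  -- Up to sign each component of M appears four times, once with each value of the second index.
  -- `hMz` then kills all four of its partial derivatives.
  obtain ⟨β₀, hβ₀⟩ : ∃ β, ∀ x ∈ U, M 1 0 x = β := by
    refine hconst (hMs 1 0) fun x hx a => ?_
    fin_cases a
    · exact hMz x hx 0 1
    · exact hneg hx (fun y hy => (hMx y hy).2.2.2.2.1) (hMz x hx 1 0)
    · exact hneg hx (fun y hy => (hMx y hy).2.2.2.2.2.2.2.2.2.2.1) (hMz x hx 2 3)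
    · exact hpos hx (fun y hy => (hMx y hy).2.2.2.2.2.2.2.2.2.2.2.2) (hMz x hx 3 2)
  obtain ⟨β₁, hβ₁⟩ : ∃ β, ∀ x ∈ U, M 2 0 x = β := by
    refine hconst (hMs 2 0) fun x hx a => ?_
    fin_cases a
    · exact hMz x hx 0 2
    · exact hpos hx (fun y hy => (hMx y hy).2.2.2.2.2.2.2.2.1) (hMz x hx 1 3)
    · exact hneg hx (fun y hy => (hMx y hy).2.2.2.2.2.1) (hMz x hx 2 0)
    · exact hneg hx (fun y hy => (hMx y hy).2.2.2.2.2.2.2.2.2.2.2.1) (hMz x hx 3 1)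
  obtain ⟨β₂, hβ₂⟩ : ∃ β, ∀ x ∈ U, M 3 0 x = β := by
    refine hconst (hMs 3 0) fun x hx a => ?_
    fin_cases a
    · exact hMz x hx 0 3
    · exact hneg hx (fun y hy => (hMx y hy).2.2.2.2.2.2.2.1) (hMz x hx 1 2)
    · exact hpos hx (fun y hy => (hMx y hy).2.2.2.2.2.2.2.2.2.1) (hMz x hx 2 1)
    · exact hneg hx (fun y hy => (hMx y hy).2.2.2.2.2.2.1) (hMz x hx 3 0)
  set α : Fin 3 → 𝕜 := ![β₀ / 2, β₁ / 2, β₂ / 2] with hα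
  have hb : ∀ b, ∃ c, ∀ x ∈ U, ξ x b - (⟨0, 0, α⟩ : CKY 𝕜).xi x b = c := by
    intro b
    refine hconst ((hξ b).sub (CKY.contDiff_xi _ b).contDiffOn) fun x hx c => ?_
    rw [pd_sub (hξd x hx b) (CKY.differentiableAt_xi _ b), CKY.pd_xi, sub_eq_zero]
    change M c b x = _
    obtain ⟨m0, m1, m2, m3, m4, m5, m6, m7, m8, m9, m10, m11, m12⟩ := hMx x hx
    have e0 := hβ₀ x hx
    have e1 := hβ₁ x hx
    have e2 := hβ₂ x hx
    fin_cases b <;> fin_cases c <;>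
      simp [asdForm, hα, m0, m1, m2, m3, m4, m5, m6, m7, m8, m9, m10, m11, m12, e0, e1, e2] <;>
      ring
  choose b hb using hb
  have hξP : ∀ x ∈ U, ξ x = (⟨0, b, α⟩ : CKY 𝕜).xi x := by
    intro x hx
    ext i
    rw [sub_eq_iff_eq_add.1 (hb i x hx)]
    simp [CKY.xi]
  have hc : ∀ i, ∃ c, ∀ x ∈ U, k x i - (⟨0, b, α⟩ : CKY 𝕜).eval x i = c := by
    intro i
    refine hconst ((hk i).sub (CKY.contDiff_eval _ i).contDiffOn) fun x hx a => ?_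
    rw [pd_sub (differentiableAt_of_smooth hU (hk i) hx) (CKY.differentiableAt_eval _ i),
      CKY.pd_eval, h x hx, hξP x hx, sub_self]
  choose c hc using hc
  refine ⟨⟨c, b, α⟩, fun x hx => ?_⟩
  ext i
  rw [sub_eq_iff_eq_add.1 (hc i x hx)]
  simp [CKY.eval]

/-- A conformally flat Kähler form is, up to a factor, a conformal Killing-Yano form. -/
theorem IsConformallyFlatKahler.exists_cky (hU : IsOpen U) (hUc : IsPreconnected U)
    (h : IsConformallyFlatKahler U Ω κ) :
    ∃ P : CKY 𝕜, (∀ x ∈ U, Ω x ^ 2 * normSq₃ (P.eval x) = 1) ∧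
      ∀ x ∈ U, κ x = Ω x ^ 3 • sdForm (P.eval x) := by
  obtain ⟨j, hj, hj1, hpar, hκ⟩ := h.exists_parallel hU
  have hΩ := h.smooth
  have hΩ0 := h.ne_zero
  have hΩi : ContDiffOn 𝕜 ∞ (fun y => (Ω y)⁻¹) U := hΩ.inv hΩ0
  -- Dividing j by Ω cancels the term w_a j of `parallelPart`; what remains is `sdPair` e_a ξ with ξ
  -- = Ω⁻²F(j)dΩ.
  obtain ⟨P, hP⟩ := exists_cky_eq (k := fun y i => (Ω y)⁻¹ * j y i)
    (ξ := fun y => fun b => (Ω y)⁻¹ ^ 2 * (sdForm (j y)).mulVec (fun c => pd Ω c y) b) hU hUc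
    (fun i => hΩi.mul (hj i))
    (fun b => by
      refine (hΩi.pow 2).mul ?_
      simp only [Matrix.mulVec, dotProduct]
      exact ContDiffOn.sum fun c _ => (contDiffOn_sdForm hj b c).mul (contDiffOn_pd hU hΩ c))
    (fun x hx a i => by
      have hd := differentiableAt_of_smooth hU hΩ hx
      have h0 := hΩ0 x hx
      have h1 := congrFun (hpar x hx a) i
      rw [pd_mul (hd.fun_inv h0) (differentiableAt_of_smooth hU (hj i) hx), h1, pd_inv hd h0]
      simp only [parallelPart, Pi.add_apply, Pi.smul_apply, smul_eq_mul, sdPair_single,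
        sdForm_mulVec]
      fin_cases a <;> fin_cases i <;> simp <;> field_simp <;> ring)
  have hjP : ∀ x ∈ U, j x = Ω x • P.eval x := by
    intro x hx
    have h0 := hΩ0 x hx
    rw [← hP x hx]
    ext i
    simp [h0]
  refine ⟨P, fun x hx => ?_, fun x hx => ?_⟩
  · rw [← hj1 x hx, hjP x hx]
    simp only [normSq₃, Pi.smul_apply, smul_eq_mul]
    ring
  · rw [hκ x hx, hjP x hx, sdForm_smul, smul_smul]
    congr 1
    ring

end KillingYano

/-! ## Curvature and uniqueness -/

section Curvature

namespace CKY

section Ring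

variable {R : Type*} [CommRing R]

/-- Half the gradient of the squared length of a conformal Killing-Yano form. -/
def grad (P : CKY R) (x : Fin 4 → R) : Fin 4 → R := (sdForm (P.eval x)).mulVec (P.xi x)

/-- Half the Hessian of the squared length of a conformal Killing-Yano form. -/
def hess (P : CKY R) (x : Fin 4 → R) (a b : Fin 4) : R :=
  (sdForm (sdPair (Pi.single b 1) (P.xi x))).mulVec (P.xi x) a
    + 2 * (sdForm (P.eval x) * asdForm P.α) a b

/-- The obstruction to flatness of the metric rescaled by the squared length of a conformal
Killing-Yano form. -/
def obstruction (P : CKY R) (x : Fin 4 → R) (a b : Fin 4) : R :=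
  2 * normSq₃ (P.eval x) * P.hess x a b - 2 * P.grad x a * P.grad x b
    - (∑ c, P.grad x c ^ 2) * (1 : Matrix (Fin 4) (Fin 4) R) a b

/-- The anti-self-dual factor of the obstruction to flatness. -/
def asdFactor (P : CKY R) (x : Fin 4 → R) : Fin 3 → R :=
  (4 * normSq₃ (P.eval x)) • P.α - asdPair (P.xi x) (P.grad x)

/-- Trace-free symmetric tensors are the span of products of anti-self-dual and self-dual forms. The
CKY equation makes this one a single product with self-dual factor k. -/
theorem obstruction_eq (P : CKY R) (x : Fin 4 → R) (a b : Fin 4) :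
    P.obstruction x a b = (asdForm (P.asdFactor x) * sdForm (P.eval x)) a b := by
  simp only [obstruction, hess, asdFactor, grad]
  generalize P.eval x = k
  generalize P.xi x = ξ
  generalize P.α = α
  simp only [sdForm_mulVec, sdPair_single, Matrix.mul_apply, Fin.sum_univ_four, normSq₃, asdPair]
  fin_cases a <;> fin_cases b <;> simp [sdForm, asdForm] <;> ring

theorem map_xi {S : Type*} [CommRing S] (f : R →+* S) (P : CKY R) (x : Fin 4 → R) (i : Fin 4) :
    f (P.xi x i) = (P.map f).xi (f ∘ x) i := by
  have h2 : f 2 = 2 := map_ofNat f 2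
  fin_cases i <;> simp [xi_apply, map, h2]

theorem map_normSq₃_eval {S : Type*} [CommRing S] (f : R →+* S) (P : CKY R) (x : Fin 4 → R) :
    f (normSq₃ (P.eval x)) = normSq₃ ((P.map f).eval (f ∘ x)) := by
  simp [normSq₃, map_eval]

theorem map_grad {S : Type*} [CommRing S] (f : R →+* S) (P : CKY R) (x : Fin 4 → R) (i : Fin 4) :
    f (P.grad x i) = (P.map f).grad (f ∘ x) i := by
  simp only [grad, sdForm_mulVec]
  fin_cases i <;> simp [map_eval, map_xi]

theorem map_hess {S : Type*} [CommRing S] (f : R →+* S) (P : CKY R) (x : Fin 4 → R)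
    (a b : Fin 4) : f (P.hess x a b) = (P.map f).hess (f ∘ x) a b := by
  simp only [hess, sdForm_mulVec, sdPair_single, Matrix.mul_apply, Fin.sum_univ_four]
  have h2 : f 2 = 2 := map_ofNat f 2
  have h : (P.map f).α = f ∘ P.α := rfl
  fin_cases a <;> fin_cases b <;> simp [map_eval, map_xi, sdForm, asdForm, h2, h]

/-- Base change lets the obstruction be treated at the generic point of a polynomial ring and then
specialised; it also passes from 𝕜 to ℂ. -/
theorem map_obstruction {S : Type*} [CommRing S] (f : R →+* S) (P : CKY R) (x : Fin 4 → R)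
    (a b : Fin 4) : f (P.obstruction x a b) = (P.map f).obstruction (f ∘ x) a b := by
  simp only [obstruction, map_sub, map_mul, map_hess, map_grad, map_normSq₃_eval, map_sum, map_pow,
    map_ofNat, Matrix.one_apply]
  split_ifs <;> simp

end Ring

end CKY

/-- The tensor product of an anti-self-dual and a self-dual form is determined by the product of
their matrices. -/
theorem mul_eq_mul_of_asdForm_mul_sdForm {R : Type*} [CommRing R] [IsDomain R] [CharZero R]
    {ν ν' k k' : Fin 3 → R} (h : asdForm ν * sdForm k = asdForm ν' * sdForm k') (m i : Fin 3) :
    ν m * k i = ν' m * k' i := by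
  have e : ∀ a b, (asdForm ν * sdForm k) a b = (asdForm ν' * sdForm k') a b := fun a b => by rw [h]
  -- The nine products of basis forms are trace-orthogonal of squared norm 4, so pairing with each
  -- isolates four times one coefficient.
  have h4 : (4 : R) ≠ 0 := OfNat.ofNat_ne_zero 4
  have e00 := e 0 0
  have e01 := e 0 1
  have e02 := e 0 2
  have e03 := e 0 3
  have e11 := e 1 1
  have e12 := e 1 2
  have e13 := e 1 3
  have e22 := e 2 2
  have e23 := e 2 3
  have e33 := e 3 3
  simp [asdForm, sdForm, Matrix.mul_apply, Fin.sum_univ_four] at e00 e01 e02 e03 e11 e12 e13 e22 e23 e33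
  apply mul_left_cancel₀ h4
  fin_cases m <;> fin_cases i <;> simp only [Fin.zero_eta, Fin.mk_one, Fin.reduceFinMk]
  · linear_combination -e00 - e11 + e22 + e33
  · linear_combination -2 * e03 - 2 * e12
  · linear_combination 2 * e02 - 2 * e13
  · linear_combination 2 * e03 - 2 * e12
  · linear_combination -e00 + e11 - e22 + e33
  · linear_combination -2 * e01 - 2 * e23
  · linear_combination -2 * e02 - 2 * e13
  · linear_combination 2 * e01 - 2 * e23
  · linear_combination -e00 + e11 + e22 - e33

section Polynomials

variable {R : Type*} [CommRing R] [IsDomain R]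

/-- With s = k·k', proportionality gives Nk' = sk without division. Pairing with k' gives s² = N²,
and a domain allows only s = ±N. -/
theorem eq_or_eq_neg_of_cross_eq_zero {k k' : Fin 3 → R} (hN : normSq₃ k = normSq₃ k')
    (h0 : normSq₃ k ≠ 0) (hx : ∀ i j, k i * k' j = k j * k' i) : k' = k ∨ k' = -k := by
  set s := k 0 * k' 0 + k 1 * k' 1 + k 2 * k' 2 with hs
  have h1 : ∀ i, normSq₃ k * k' i = s * k i := by
    intro i
    simp only [normSq₃, hs]
    linear_combination k 0 * hx 0 i + k 1 * hx 1 i + k 2 * hx 2 i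
  have h2 : (s - normSq₃ k) * (s + normSq₃ k) = 0 := by
    have h3 : normSq₃ k * (normSq₃ k' - normSq₃ k) = 0 := by rw [hN]; ring
    have h4 : normSq₃ k * normSq₃ k' = s * s := by
      have : normSq₃ k * normSq₃ k' = k' 0 * (normSq₃ k * k' 0) + k' 1 * (normSq₃ k * k' 1)
        + k' 2 * (normSq₃ k * k' 2) := by simp only [normSq₃]; ring
      rw [this, h1, h1, h1, hs]; ring
    linear_combination h3 - h4
  rcases mul_eq_zero.1 h2 with h3 | h3
  · left
    ext i
    apply mul_left_cancel₀ h0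
    linear_combination h1 i + k i * h3
  · right
    ext i
    apply mul_left_cancel₀ h0
    rw [Pi.neg_apply]
    linear_combination h1 i + k i * h3

end Polynomials

section Calculus

variable {𝕜 : Type*} [RCLike 𝕜] {x : Pt 𝕜} {U : Set (Pt 𝕜)} {Ω : Pt 𝕜 → 𝕜}

namespace CKY

theorem contDiff_grad (P : CKY 𝕜) (a : Fin 4) : ContDiff 𝕜 ∞ (fun y : Pt 𝕜 => P.grad y a) := by
  have h := P.contDiff_eval
  have h' := P.contDiff_xi
  have h0 := h 0
  have h1 := h 1
  have h2 := h 2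
  have g0 := h' 0
  have g1 := h' 1
  have g2 := h' 2
  have g3 := h' 3
  simp only [grad, sdForm_mulVec]
  fin_cases a <;> simp <;> fun_prop

theorem differentiableAt_grad (P : CKY 𝕜) (a : Fin 4) :
    DifferentiableAt 𝕜 (fun y : Pt 𝕜 => P.grad y a) x :=
  (P.contDiff_grad a).contDiffAt.differentiableAt (by simp)

theorem pd_grad (P : CKY 𝕜) (a b : Fin 4) (x : Pt 𝕜) :
    pd (fun y => P.grad y a) b x = P.hess x a b := by
  have hk := P.differentiableAt_eval (x := x)
  have hξ := P.differentiableAt_xi (x := x)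
  have hF : ∀ c, DifferentiableAt 𝕜 (fun y => sdForm (P.eval y) a c) x := fun c =>
    differentiableAt_sdForm hk a c
  have h1 : ∀ c, pd (fun y => sdForm (P.eval y) a c * P.xi y c) b x =
      sdForm (sdPair (Pi.single b 1) (P.xi x)) a c * P.xi x c
        + 2 * (sdForm (P.eval x) a c * asdForm P.α c b) := by
    intro c
    rw [pd_mul (hF c) (hξ c), pd_xi, pd_sdForm]
    simp only [P.pd_eval]
    ring
  simp only [grad, hess, Matrix.mulVec, dotProduct, Matrix.mul_apply]
  rw [pd_sum _ (fun c _ => (hF c).fun_mul (hξ c))]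
  simp only [h1, Finset.sum_add_distrib, Finset.mul_sum]

/-- The obstruction is built from the squared length and its first two derivatives only. -/
theorem obstruction_eq_of_normSq₃_eq {P P' : CKY 𝕜}
    (h : ∀ x : Pt 𝕜, normSq₃ (P.eval x) = normSq₃ (P'.eval x)) (x : Pt 𝕜) (a b : Fin 4) :
    P.obstruction x a b = P'.obstruction x a b := by
  have hg : ∀ x : Pt 𝕜, ∀ a, P.grad x a = P'.grad x a := by
    intro x a
    have h1 := P.pd_normSq a x
    have h2 := P'.pd_normSq a x
    rw [show (fun y => normSq₃ (P.eval y)) = fun y => normSq₃ (P'.eval y) from funext h, h2] at h1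
    exact (mul_left_cancel₀ two_ne_zero h1).symm
  have hh : P.hess x a b = P'.hess x a b := by
    rw [← pd_grad, ← pd_grad, show (fun y => P.grad y a) = fun y => P'.grad y a from
      funext fun y => hg y a]
  simp only [obstruction, h, hg, hh]

/-- Two conformal Killing-Yano forms of the same length are equal up to sign, unless the
rescaled metric is flat. -/
theorem eq_or_eq_neg_or_obstruction_eq_zero {P P' : CKY ℂ}
    (h : ∀ x : Pt ℂ, normSq₃ (P.eval x) = normSq₃ (P'.eval x))
    (h0 : ∃ x : Pt ℂ, normSq₃ (P.eval x) ≠ 0) :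
    (∀ x : Pt ℂ, P'.eval x = P.eval x) ∨ (∀ x : Pt ℂ, P'.eval x = -P.eval x) ∨
      ∀ (x : Pt ℂ) (a b : Fin 4), P.obstruction x a b = 0 := by
  let X : Fin 4 → MvPolynomial (Fin 4) ℂ := MvPolynomial.X
  let e : Pt ℂ → MvPolynomial (Fin 4) ℂ →+* ℂ := fun y => MvPolynomial.eval y
  have hmap : ∀ (P : CKY ℂ) (y : Pt ℂ), (P.map MvPolynomial.C).map (e y) = P := by
    intro P y
    simp only [map, e]
    congr 1 <;> (ext i; simp)
  have hX : ∀ y : Pt ℂ, e y ∘ X = y := by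
    intro y; ext i; simp [e, X]
  have hN : normSq₃ ((P.map MvPolynomial.C).eval X) = normSq₃ ((P'.map MvPolynomial.C).eval X) := by
    refine MvPolynomial.funext fun y => ?_
    change e y _ = e y _
    rw [map_normSq₃_eval, map_normSq₃_eval, hmap, hmap, hX, h]
  have hN0 : normSq₃ ((P.map MvPolynomial.C).eval X) ≠ 0 := by
    obtain ⟨y, hy⟩ := h0
    intro h1
    apply hy
    have := congrArg (e y) h1
    rwa [map_normSq₃_eval, hmap, hX, map_zero] at this
  have hE : ∀ a b, (P.map MvPolynomial.C).obstruction X a b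
      = (P'.map MvPolynomial.C).obstruction X a b := by
    intro a b
    refine MvPolynomial.funext fun y => ?_
    change e y _ = e y _
    rw [map_obstruction, map_obstruction, hmap, hmap, hX]
    exact obstruction_eq_of_normSq₃_eq h y a b
  have hT := mul_eq_mul_of_asdForm_mul_sdForm (ν := (P.map MvPolynomial.C).asdFactor X)
    (ν' := (P'.map MvPolynomial.C).asdFactor X) (k := (P.map MvPolynomial.C).eval X)
    (k' := (P'.map MvPolynomial.C).eval X) (by
      ext1 a b
      rw [← obstruction_eq, ← obstruction_eq, hE])
  -- Proportional polynomial vectors of equal length agree up to one global sign. Otherwise ν ⊗ k =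
  -- ν' ⊗ k' yields ν·(k_i k'_j - k_j k'_i) = 0 with a nonzero minor, so ν = 0.
  by_cases hx : ∀ i j, (P.map MvPolynomial.C).eval X i * (P'.map MvPolynomial.C).eval X j
      = (P.map MvPolynomial.C).eval X j * (P'.map MvPolynomial.C).eval X i
  · have hev : ∀ (P : CKY ℂ) (y : Pt ℂ) i, e y ((P.map MvPolynomial.C).eval X i) = P.eval y i := by
      intro P y i
      rw [map_eval, hmap, hX]
    rcases eq_or_eq_neg_of_cross_eq_zero hN hN0 hx with h1 | h1
    · left
      intro y
      ext i
      rw [← hev, ← hev, h1]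
    · right; left
      intro y
      ext i
      rw [Pi.neg_apply, ← hev, ← hev, h1, Pi.neg_apply, map_neg]
  · right; right
    push Not at hx
    obtain ⟨i, j, hij⟩ := hx
    have hν : (P.map MvPolynomial.C).asdFactor X = 0 := by
      ext1 m
      have : (P.map MvPolynomial.C).asdFactor X m *
          ((P.map MvPolynomial.C).eval X i * (P'.map MvPolynomial.C).eval X j
          - (P.map MvPolynomial.C).eval X j * (P'.map MvPolynomial.C).eval X i) = 0 := by
        linear_combination (P'.map MvPolynomial.C).eval X j * hT m i
          - (P'.map MvPolynomial.C).eval X i * hT m j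
      exact (mul_eq_zero.1 this).resolve_right (sub_ne_zero.2 hij)
    intro y a b
    have h1 : (P.map MvPolynomial.C).obstruction X a b = 0 := by
      rw [obstruction_eq, hν, show asdForm (0 : Fin 3 → MvPolynomial (Fin 4) ℂ) = 0 by
        ext1 i j; fin_cases i <;> fin_cases j <;> simp [asdForm]]
      simp
    have h2 := congrArg (e y) h1
    rwa [map_obstruction, hmap, hX, map_zero] at h2

end CKY

end Calculus

end Curvature

/-! ## Flatness -/

section Flatness

/-- The Christoffel symbols of the metric `exp (2 f) δ` with `ℓ = df`. -/
def conformalChristoffel {R : Type*} [CommRing R] (l : Fin 4 → R) (c a b : Fin 4) : R :=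
  l a * (1 : Matrix (Fin 4) (Fin 4) R) c b + l b * (1 : Matrix (Fin 4) (Fin 4) R) c a
    - l c * (1 : Matrix (Fin 4) (Fin 4) R) a b

theorem one_matrix_symm {R : Type*} [CommRing R] (a b : Fin 4) :
    (1 : Matrix (Fin 4) (Fin 4) R) a b = (1 : Matrix (Fin 4) (Fin 4) R) b a := by
  simp [Matrix.one_apply, eq_comm]

/-- Contracting with the Kronecker deltas left symbolic reduces the curvature to a ring identity,
without a case split over indices. -/
theorem sum_conformalChristoffel_mul {R : Type*} [CommRing R] (l G : Fin 4 → R) (d a : Fin 4) :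
    ∑ e, conformalChristoffel l d a e * G e
      = l a * G d + (1 : Matrix (Fin 4) (Fin 4) R) d a * ∑ e, l e * G e - l d * G a := by
  have h : ∀ c, ∑ e, (1 : Matrix (Fin 4) (Fin 4) R) c e * G e = G c := fun c => by
    simp [Matrix.one_apply]
  calc _ = ∑ e, (l a * ((1 : Matrix (Fin 4) (Fin 4) R) d e * G e)
        + (1 : Matrix (Fin 4) (Fin 4) R) d a * (l e * G e)
        - l d * ((1 : Matrix (Fin 4) (Fin 4) R) a e * G e)) :=
        Finset.sum_congr rfl fun e _ => by simp only [conformalChristoffel]; ring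
    _ = _ := by
      rw [Finset.sum_sub_distrib, Finset.sum_add_distrib, ← Finset.mul_sum, ← Finset.mul_sum,
        ← Finset.mul_sum, h, h]

theorem sum_mul_conformalChristoffel {R : Type*} [CommRing R] (l : Fin 4 → R) (b c : Fin 4) :
    ∑ e, l e * conformalChristoffel l e b c
      = 2 * l b * l c - (1 : Matrix (Fin 4) (Fin 4) R) b c * ∑ e, l e ^ 2 := by
  have h : ∀ c, ∑ e, l e * (1 : Matrix (Fin 4) (Fin 4) R) e c = l c := fun c => by
    simp [Matrix.one_apply]
  calc _ = ∑ e, (l b * (l e * (1 : Matrix (Fin 4) (Fin 4) R) e c)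
        + l c * (l e * (1 : Matrix (Fin 4) (Fin 4) R) e b)
        - (1 : Matrix (Fin 4) (Fin 4) R) b c * l e ^ 2) :=
        Finset.sum_congr rfl fun e _ => by simp only [conformalChristoffel]; ring
    _ = _ := by
      rw [Finset.sum_sub_distrib, Finset.sum_add_distrib, ← Finset.mul_sum, ← Finset.mul_sum,
        ← Finset.mul_sum, h, h]
      ring

variable {𝕜 : Type*} [RCLike 𝕜] {x : Pt 𝕜} {U : Set (Pt 𝕜)} {Ω : Pt 𝕜 → 𝕜}

theorem christoffel_conformalMetric {l : Fin 4 → 𝕜} (hΩ : DifferentiableAt 𝕜 Ω x) (h0 : Ω x ≠ 0)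
    (hl : ∀ a, pd Ω a x = Ω x * l a) (c a b : Fin 4) :
    christoffel (conformalMetric Ω) c a b x = conformalChristoffel l c a b := by
  have h1 : ∀ a b d, pd (fun y => conformalMetric Ω y a b) d x
      = 2 * Ω x ^ 2 * l d * (1 : Matrix (Fin 4) (Fin 4) 𝕜) a b := by
    intro a b d
    simp only [conformalMetric, Matrix.smul_apply, smul_eq_mul]
    rw [pd_mul (f := fun y => Ω y ^ 2) (hΩ.pow 2) (differentiableAt_const _), pd_sq hΩ, hl,
      pd_const]
    ring
  have h2 : (conformalMetric Ω x)⁻¹ = (Ω x ^ 2)⁻¹ • (1 : Matrix (Fin 4) (Fin 4) 𝕜) := by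
    refine Matrix.inv_eq_right_inv ?_
    rw [conformalMetric, smul_mul_smul_comm, mul_inv_cancel₀ (pow_ne_zero 2 h0), one_smul, one_mul]
  simp only [christoffel, h1, h2, Matrix.smul_apply, smul_eq_mul]
  rw [Finset.sum_eq_single c (fun d _ hd => by rw [Matrix.one_apply_ne hd.symm]; ring) (by simp),
    Matrix.one_apply_eq, conformalChristoffel]
  field_simp

/-- Conformally rescaled metrics whose logarithmic derivative satisfies the conformal flatness
equation are flat. -/
theorem isFlatOn_conformalMetric {l : Pt 𝕜 → Fin 4 → 𝕜} (hU : IsOpen U)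
    (hΩ : ContDiffOn 𝕜 ∞ Ω U) (h0 : ∀ x ∈ U, Ω x ≠ 0)
    (hld : ∀ x ∈ U, ∀ a, DifferentiableAt 𝕜 (fun y => l y a) x)
    (hl : ∀ x ∈ U, ∀ a, pd Ω a x = Ω x * l x a)
    (hp : ∀ x ∈ U, ∀ a b, pd (fun y => l y a) b x = l x a * l x b
      - (1 / 2) * (∑ e, l x e ^ 2) * (1 : Matrix (Fin 4) (Fin 4) 𝕜) a b) :
    IsFlatOn (conformalMetric Ω) U := by
  intro x hx d c a b
  have hΓ : ∀ y ∈ U, ∀ c a b,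
      christoffel (conformalMetric Ω) c a b y = conformalChristoffel (l y) c a b :=
    fun y hy => christoffel_conformalMetric (differentiableAt_of_smooth hU hΩ hy) (h0 y hy) (hl y hy)
  have hc : ∀ a (t : 𝕜), DifferentiableAt 𝕜 (fun y => l y a * t) x := fun a t =>
    (hld x hx a).mul_const t
  have hmc : ∀ a e (t : 𝕜), pd (fun y => l y a * t) e x = t * pd (fun y => l y a) e x :=
    fun a e t => by
      rw [pd_mul (hld x hx a) (differentiableAt_const t), pd_const]; ring
  have hpΓ : ∀ e c a b, pd (christoffel (conformalMetric Ω) c a b) e x =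
      (1 : Matrix (Fin 4) (Fin 4) 𝕜) c b * pd (fun y => l y a) e x
      + (1 : Matrix (Fin 4) (Fin 4) 𝕜) c a * pd (fun y => l y b) e x
      - (1 : Matrix (Fin 4) (Fin 4) 𝕜) a b * pd (fun y => l y c) e x := by
    intro e c a b
    rw [pd_congr_on hU hx (fun y hy => hΓ y hy c a b)]
    simp only [conformalChristoffel]
    rw [pd_sub ((hc _ _).fun_add (hc _ _)) (hc _ _), pd_add (hc _ _) (hc _ _), hmc, hmc, hmc]
  simp only [riemann, hpΓ, hΓ x hx, Finset.sum_sub_distrib, sum_conformalChristoffel_mul,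
    sum_mul_conformalChristoffel, hp x hx]
  simp only [conformalChristoffel]
  rw [one_matrix_symm b a, one_matrix_symm c a, one_matrix_symm c b, one_matrix_symm d a,
    one_matrix_symm d b, one_matrix_symm d c]
  ring

theorem CKY.isFlatOn_of_obstruction_eq_zero (P : CKY 𝕜) (hU : IsOpen U) (hΩ : ContDiffOn 𝕜 ∞ Ω U)
    (hN : ∀ x ∈ U, Ω x ^ 2 * normSq₃ (P.eval x) = 1)
    (h : ∀ x ∈ U, ∀ a b, P.obstruction x a b = 0) : IsFlatOn (conformalMetric Ω) U := by
  have hd : ∀ x ∈ U, DifferentiableAt 𝕜 Ω x := fun x hx => differentiableAt_of_smooth hU hΩ hx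
  have hpd : ∀ x ∈ U, ∀ a, pd Ω a x = Ω x * (-Ω x ^ 2 * P.grad x a) := fun x hx a => by
    rw [pd_conformalFactor P hU hΩ hN hx, grad]; ring
  have hsq : ∀ x ∈ U, DifferentiableAt 𝕜 (fun y => -Ω y ^ 2) x := fun x hx => ((hd x hx).pow 2).neg
  -- Ω² = 1/N gives d log Ω = -dN/(2N) = -Ω² `grad`.
  refine isFlatOn_conformalMetric (l := fun y a => -Ω y ^ 2 * P.grad y a) hU hΩ
    (fun x hx h => by simpa [h] using hN x hx)
    (fun x hx a => (hsq x hx).mul (P.differentiableAt_grad a)) hpd fun x hx a b => ?_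
  rw [pd_mul (f := fun y => -Ω y ^ 2) (hsq x hx) (P.differentiableAt_grad a), pd_grad, pd_neg,
    pd_sq (hd x hx), hpd x hx]
  have h1 := h x hx a b
  have h2 := hN x hx
  have h3 : ∑ e, (-Ω x ^ 2 * P.grad x e) ^ 2 = Ω x ^ 4 * ∑ e, P.grad x e ^ 2 := by
    rw [Finset.mul_sum]
    exact Finset.sum_congr rfl fun e _ => by ring
  rw [h3]
  rw [obstruction] at h1
  linear_combination (-Ω x ^ 4 / 2) * h1 + Ω x ^ 2 * P.hess x a b * h2

end Flatness

/-! ## Complexification -/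

section Complexification

variable {𝕜 : Type*} [RCLike 𝕜] {x : Pt 𝕜} {U : Set (Pt 𝕜)} {Ω : Pt 𝕜 → 𝕜}
  {κ κ' : Pt 𝕜 → Matrix (Fin 4) (Fin 4) 𝕜}

theorem rclike_map_mul (y z : 𝕜) :
    RCLike.map 𝕜 ℂ (y * z) = RCLike.map 𝕜 ℂ y * RCLike.map 𝕜 ℂ z := by
  rcases RCLike.I_eq_zero_or_im_I_eq_one (K := 𝕜) with h | h
  · simp [RCLike.map_apply, RCLike.im_eq_zero h]
  · apply Complex.ext <;> simp [RCLike.map_apply]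

variable (𝕜) in
/-- The inclusion `𝕜 → ℂ` as a ring homomorphism. -/
def complexEmbedding : 𝕜 →+* ℂ where
  toFun := RCLike.map 𝕜 ℂ
  map_one' := by simp [RCLike.map_apply]
  map_mul' := rclike_map_mul
  map_zero' := map_zero _
  map_add' := map_add _

theorem complexEmbedding_injective : Function.Injective (complexEmbedding 𝕜) :=
  (complexEmbedding 𝕜).injective

theorem toC_eq (x : Pt 𝕜) : toC x = complexEmbedding 𝕜 ∘ x := rfl

theorem continuous_toC : Continuous (toC : Pt 𝕜 → Pt ℂ) :=
  continuous_pi fun a => (RCLike.map 𝕜 ℂ).continuous.comp (continuous_apply a)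

/-- For 𝕜 = ℝ the projection is the real part, which is not multiplicative; linearity over 𝕜 is what
survives. -/
theorem rclike_map_complexEmbedding_mul (y : 𝕜) (z : ℂ) :
    RCLike.map ℂ 𝕜 (complexEmbedding 𝕜 y * z) = y * RCLike.map ℂ 𝕜 z := by
  rcases RCLike.I_eq_zero_or_im_I_eq_one (K := 𝕜) with h | h
  · apply RCLike.ext <;>
      simp [complexEmbedding, RCLike.map_apply, RCLike.im_eq_zero h, h]
  · apply RCLike.ext <;>
      simp [complexEmbedding, RCLike.map_apply, h]

theorem rclike_map_complexEmbedding (y : 𝕜) :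
    RCLike.map ℂ 𝕜 (complexEmbedding 𝕜 y) = y := by
  rw [← mul_one (complexEmbedding 𝕜 y), rclike_map_complexEmbedding_mul]
  simp [RCLike.map_apply]

/-- `eval` is linear in the parameters with coefficients in 𝕜 at points of 𝕜⁴, so linearity of the
projection suffices. -/
theorem CKY.rclike_map_eval (P : CKY ℂ) (x : Pt 𝕜) (i : Fin 3) :
    RCLike.map ℂ 𝕜 (P.eval (toC x) i) = (P.map (RCLike.map ℂ 𝕜)).eval x i := by
  have h := rclike_map_complexEmbedding_mul (𝕜 := 𝕜)
  have h' : ∀ (y : 𝕜) (z : ℂ),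
      RCLike.map ℂ 𝕜 (z * complexEmbedding 𝕜 y) = RCLike.map ℂ 𝕜 z * y := fun y z => by
    rw [mul_comm, h, mul_comm]
  simp only [eval_apply, toC_eq, Function.comp_apply]
  fin_cases i <;> simp [-RCLike.map_apply, h, h', map]

theorem CKY.eval_map_complexEmbedding (P : CKY 𝕜) (x : Pt 𝕜) :
    (P.map (complexEmbedding 𝕜)).eval (toC x) = complexEmbedding 𝕜 ∘ P.eval x := by
  ext i
  rw [toC_eq, ← map_eval, Function.comp_apply]

theorem normSq₃_complexEmbedding (v : Fin 3 → 𝕜) :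
    normSq₃ (complexEmbedding 𝕜 ∘ v) = complexEmbedding 𝕜 (normSq₃ v) := by
  simp [normSq₃]

theorem sdForm_complexEmbedding (v : Fin 3 → 𝕜) :
    sdForm (complexEmbedding 𝕜 ∘ v) = (sdForm v).map (complexEmbedding 𝕜) := by
  ext i j
  fin_cases i <;> fin_cases j <;> simp [sdForm]

/-- A polynomial on `ℂ⁴` is determined by its values on an open subset of `𝕜⁴`. -/
theorem mvPolynomial_eq_of_eqOn_toC (hU : IsOpen U) (hne : U.Nonempty)
    {p q : MvPolynomial (Fin 4) ℂ}
    (h : ∀ x ∈ U, MvPolynomial.eval (toC x) p = MvPolynomial.eval (toC x) q) : p = q := by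
  obtain ⟨x, hx⟩ := hne
  obtain ⟨r, hr, hball⟩ := Metric.isOpen_iff.1 hU x hx
  -- A polynomial is determined by its values on a product of infinite sets; U contains a box.
  refine MvPolynomial.funext_set (fun a => complexEmbedding 𝕜 '' Metric.ball (x a) r)
    (fun a => ?_) fun y hy => ?_
  · exact (infinite_of_mem_nhds (x a) (Metric.ball_mem_nhds _ hr)).image
      complexEmbedding_injective.injOn
  · choose z hz hzy using fun a => hy a (Set.mem_univ a)
    have hzU : z ∈ U := hball (by rw [ball_pi x hr]; exact fun a _ => hz a)
    have : y = toC z := funext fun a => (hzy a).symm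
    rw [this]
    exact h z hzU

theorem CKY.normSq₃_eval_eq_of_eqOn_toC {P P' : CKY ℂ} (hU : IsOpen U) (hne : U.Nonempty)
    (h : ∀ x ∈ U, normSq₃ (P.eval (toC x)) = normSq₃ (P'.eval (toC x))) (y : Pt ℂ) :
    normSq₃ (P.eval y) = normSq₃ (P'.eval y) := by
  have hp : ∀ (P : CKY ℂ) (y : Pt ℂ), MvPolynomial.eval y
      (normSq₃ ((P.map MvPolynomial.C).eval MvPolynomial.X)) = normSq₃ (P.eval y) := by
    intro P y
    rw [map_normSq₃_eval]
    congr 2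
    · simp only [map]
      congr 1 <;> (ext i; simp)
    · ext i; simp
  have := mvPolynomial_eq_of_eqOn_toC hU hne
    (p := normSq₃ ((P.map MvPolynomial.C).eval MvPolynomial.X))
    (q := normSq₃ ((P'.map MvPolynomial.C).eval MvPolynomial.X))
    (fun x hx => by rw [hp, hp, h x hx])
  rw [← hp, ← hp, this]

end Complexification

/-! ## Quadrics and conformally flat Kähler structures -/

section Quadrics

variable {𝕜 : Type*} [RCLike 𝕜] {U : Set (Pt 𝕜)} {Ω : Pt 𝕜 → 𝕜}
  {κ κ' : Pt 𝕜 → Matrix (Fin 4) (Fin 4) 𝕜} {a b c : Matrix (Fin 2) (Fin 2) ℂ}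
  {Γ : Pt 𝕜 → ℝ → Fin 2 → ℂ}

theorem exists_quadricOf_eq {Q : Matrix TIdx TIdx ℂ} (hQ : Q.IsSymm) :
    ∃ a b c, a.IsSymm ∧ c.IsSymm ∧ quadricOf a b c = Q := by
  have h : ∀ α β, Q β α = Q α β := fun α β => hQ.apply α β
  refine ⟨(2 * Complex.I) • Q.toBlocks₁₁, (2 * Complex.I) • Q.toBlocks₁₂,
    (2 * Complex.I) • Q.toBlocks₂₂, ?_, ?_, ?_⟩
  · ext A B
    simp [Matrix.toBlocks₁₁, h (Sum.inl A) (Sum.inl B)]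
  · ext A B
    simp [Matrix.toBlocks₂₂, h (Sum.inr A) (Sum.inr B)]
  · ext (A | A) (B | B) <;>
      simp [quadricOf, Matrix.toBlocks₁₁, Matrix.toBlocks₁₂, Matrix.toBlocks₂₂, ← mul_assoc,
        h (Sum.inl _) (Sum.inr _)]

theorem exists_generatesFactor (ha : a.IsSymm) (hc : c.IsSymm) (hU : IsOpen U)
    (hΩ : ContinuousOn Ω U)
    (hN : ∀ x ∈ U, complexEmbedding 𝕜 (Ω x) ^ 2 * normSq₃ ((ckyOf a b c).eval (toC x)) = 1) :
    ∃ Γ, GeneratesFactor (quadricOf a b c) U Γ Ω := by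
  have h : ∀ p : Pt 𝕜, ∃ γ : ℝ → Fin 2 → ℂ, p ∈ U → ∀ᶠ x in 𝓝 p,
      IsSeparatingContour (chiOnLine (quadricOf a b c) (toC x)) γ ∧
        RCLike.map 𝕜 ℂ (Ω x) = scalarField (quadricOf a b c) γ (toC x) := by
    intro p
    by_cases hp : p ∈ U
    · obtain ⟨γ, hγ⟩ := exists_contour (f := fun x => RCLike.map 𝕜 ℂ (Ω x))
        continuous_toC.continuousAt ha hc
        ((RCLike.map 𝕜 ℂ).continuous.continuousAt.comp (hΩ.continuousAt (hU.mem_nhds hp)))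
        (Filter.eventually_of_mem (hU.mem_nhds hp) hN)
      exact ⟨γ, fun _ => hγ⟩
    · exact ⟨fun _ => 0, fun h => absurd h hp⟩
  choose Γ hΓ using h
  exact ⟨Γ, hΓ⟩

theorem GeneratesFactor.fields (h : GeneratesFactor (quadricOf a b c) U Γ Ω) (ha : a.IsSymm)
    (hc : c.IsSymm) {p : Pt 𝕜} (hp : p ∈ U) :
    ∀ᶠ x in 𝓝 p, IsSeparatingContour (chiOnLine (quadricOf a b c) (toC x)) (Γ p) ∧
      complexEmbedding 𝕜 (Ω x) ^ 2 * normSq₃ ((ckyOf a b c).eval (toC x)) = 1 ∧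
      quadricForm (quadricOf a b c) (Γ p) (toC x) =
        complexEmbedding 𝕜 (Ω x) ^ 3 • sdForm ((ckyOf a b c).eval (toC x)) := by
  filter_upwards [h p hp] with x hx
  have hφ : complexEmbedding 𝕜 (Ω x) = scalarField (quadricOf a b c) (Γ p) (toC x) := hx.2
  rw [hφ]
  exact ⟨hx.1, separating_contour_fields ha hc hx.1⟩

theorem GeneratesFactor.generatesForm (h : GeneratesFactor (quadricOf a b c) U Γ Ω)
    (ha : a.IsSymm) (hc : c.IsSymm) (hU : IsOpen U)
    (hκ : ∀ x ∈ U, (κ x).map (complexEmbedding 𝕜) =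
      complexEmbedding 𝕜 (Ω x) ^ 3 • sdForm ((ckyOf a b c).eval (toC x))) :
    GeneratesForm (quadricOf a b c) U Γ κ := by
  intro p hp
  filter_upwards [h.fields ha hc hp, hU.mem_nhds hp] with x hx hxU
  exact ⟨hx.1, (hκ x hxU).trans hx.2.2.symm⟩

/-- If the 2-form generated by a quadric has values in `𝕜`, then it is the Kähler form of a
conformally flat Kähler structure. -/
theorem GeneratesFactor.isConformallyFlatKahler
    (h : GeneratesFactor (quadricOf a b c) U Γ Ω) (ha : a.IsSymm) (hc : c.IsSymm) (hU : IsOpen U)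
    (hΩ : ContDiffOn 𝕜 ∞ Ω U)
    (hκ : ∀ x ∈ U, (κ x).map (RCLike.map 𝕜 ℂ) = quadricForm (quadricOf a b c) (Γ x) (toC x)) :
    IsConformallyFlatKahler U Ω κ ∧ GeneratesForm (quadricOf a b c) U Γ κ := by
  set P := ckyOf a b c with hP
  have hκ' : ∀ x ∈ U, (κ x).map (complexEmbedding 𝕜) =
      complexEmbedding 𝕜 (Ω x) ^ 3 • sdForm (P.eval (toC x)) := fun x hx =>
    (hκ x hx).trans (h.fields ha hc hx).self_of_nhds.2.2
  have hN : ∀ x ∈ U, complexEmbedding 𝕜 (Ω x) ^ 2 * normSq₃ (P.eval (toC x)) = 1 := fun x hx =>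
    (h.fields ha hc hx).self_of_nhds.2.1
  refine ⟨?_, h.generatesForm ha hc hU hκ'⟩
  -- Because Ω and κ are 𝕜-valued, so are the values of P on U. Projecting the parameters of P to 𝕜
  -- leaves these values unchanged.
  have hE : ∀ x ∈ U,
      P.eval (toC x) = complexEmbedding 𝕜 ∘ (P.map (RCLike.map ℂ 𝕜)).eval x := by
    intro x hx
    have h0 : complexEmbedding 𝕜 (Ω x) ≠ 0 := fun h0 => by simpa [h0] using hN x hx
    have hr : ∀ i, ∃ y, P.eval (toC x) i = complexEmbedding 𝕜 y := by
      intro i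
      refine ⟨κ x 0 (![1, 2, 3] i) / Ω x ^ 3, ?_⟩
      have := congrFun (congrFun (hκ' x hx) 0) (![1, 2, 3] i)
      rw [Matrix.map_apply] at this
      rw [map_div₀, map_pow, this, Matrix.smul_apply, smul_eq_mul,
        mul_div_cancel_left₀ _ (pow_ne_zero 3 h0)]
      fin_cases i <;> simp [sdForm]
    ext i
    obtain ⟨y, hy⟩ := hr i
    rw [Function.comp_apply, ← CKY.rclike_map_eval, hy, rclike_map_complexEmbedding]
  refine isConformallyFlatKahler_of_cky (P.map (RCLike.map ℂ 𝕜)) hU hΩ (fun x hx => ?_)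
    fun x hx => ?_
  · apply complexEmbedding_injective
    rw [map_mul, map_pow, ← normSq₃_complexEmbedding, ← hE x hx, hN x hx, map_one]
  · ext i j
    apply complexEmbedding_injective
    have := congrFun (congrFun (hκ' x hx) i) j
    rw [Matrix.map_apply, hE x hx, sdForm_complexEmbedding] at this
    simp [this]

/-- Every conformally flat Kähler structure is generated by a quadric. -/
theorem IsConformallyFlatKahler.exists_quadricOf (h : IsConformallyFlatKahler U Ω κ)
    (hU : IsOpen U) (hUc : IsPreconnected U) :
    ∃ a b c : Matrix (Fin 2) (Fin 2) ℂ, a.IsSymm ∧ c.IsSymm ∧ IsTwistorQuadric (quadricOf a b c) ∧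
      (∃ Γ, GeneratesFactor (quadricOf a b c) U Γ Ω ∧ GeneratesForm (quadricOf a b c) U Γ κ) ∧
      ∀ x ∈ U, 2 * (RCLike.map 𝕜 ℂ (Ω x) ^ 2)⁻¹ = quartic a b c (toC x) := by
  -- Over the empty set any nondegenerate quadric will do; c = 1 has det K = 1.
  rcases U.eq_empty_or_nonempty with rfl | ⟨x₀, hx₀⟩
  · refine ⟨0, 0, 1, Matrix.isSymm_zero, Matrix.isSymm_one,
      isTwistorQuadric_quadricOf (x := 0) Matrix.isSymm_zero Matrix.isSymm_one ?_,
      ⟨fun _ _ => 0, fun _ hp => hp.elim, fun _ hp => hp.elim⟩, fun _ hx => hx.elim⟩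
    rw [eval_ckyOf Matrix.isSymm_zero,
      normSq₃_spinorVec (lineSpinor_isSymm Matrix.isSymm_zero Matrix.isSymm_one _)]
    simp [lineSpinor]
  obtain ⟨P, hN, hκ⟩ := h.exists_cky hU hUc
  obtain ⟨a, b, c, ha, hc, hP⟩ := exists_ckyOf_eq (P.map (complexEmbedding 𝕜))
  have hE : ∀ x, (ckyOf a b c).eval (toC x) = complexEmbedding 𝕜 ∘ P.eval x := fun x => by
    rw [hP, P.eval_map_complexEmbedding]
  have hN' : ∀ x ∈ U,
      complexEmbedding 𝕜 (Ω x) ^ 2 * normSq₃ ((ckyOf a b c).eval (toC x)) = 1 := fun x hx => by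
    rw [hE, normSq₃_complexEmbedding, ← map_pow, ← map_mul, hN x hx, map_one]
  obtain ⟨Γ, hΓ⟩ := exists_generatesFactor ha hc hU h.smooth.continuousOn hN'
  refine ⟨a, b, c, ha, hc,
    isTwistorQuadric_quadricOf ha hc (x := toC x₀) fun h0 => by simpa [h0] using hN' x₀ hx₀,
    ⟨Γ, hΓ, hΓ.generatesForm ha hc hU fun x hx => ?_⟩, fun x hx => ?_⟩
  · rw [hE, sdForm_complexEmbedding, hκ x hx]
    ext i j
    simp
  · rw [quartic_eq ha hc, eq_inv_of_mul_eq_one_right (hN' x hx)]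
    rfl

/-- The Kähler form of a conformally flat, non-flat Kähler structure is determined up to sign by
a quadric generating the conformal factor. -/
theorem IsConformallyFlatKahler.generatesForm_or_neg (h : IsConformallyFlatKahler U Ω κ)
    (hU : IsOpen U) (hUc : IsPreconnected U) (ha : a.IsSymm) (hc : c.IsSymm)
    (hΓ : GeneratesFactor (quadricOf a b c) U Γ Ω) (hflat : ¬ IsFlatOn (conformalMetric Ω) U) :
    GeneratesForm (quadricOf a b c) U Γ κ ∨ GeneratesForm (quadricOf a b c) U Γ fun x => -κ x := by
  rcases U.eq_empty_or_nonempty with rfl | hne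
  · exact absurd (fun x hx => hx.elim) hflat
  obtain ⟨P, hN, hκ⟩ := h.exists_cky hU hUc
  have hE := P.eval_map_complexEmbedding
  have hNP : ∀ x ∈ U, complexEmbedding 𝕜 (Ω x) ^ 2
      * normSq₃ ((P.map (complexEmbedding 𝕜)).eval (toC x)) = 1 := fun x hx => by
    rw [hE, normSq₃_complexEmbedding, ← map_pow, ← map_mul, hN x hx, map_one]
  -- Both squared lengths are Ω⁻² on U, hence equal as polynomials on ℂ⁴.
  have heq : ∀ x ∈ U, normSq₃ ((P.map (complexEmbedding 𝕜)).eval (toC x))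
      = normSq₃ ((ckyOf a b c).eval (toC x)) := fun x hx => by
    rw [eq_inv_of_mul_eq_one_right (hNP x hx),
      eq_inv_of_mul_eq_one_right (hΓ.fields ha hc hx).self_of_nhds.2.1]
  have h0 : ∃ y, normSq₃ ((P.map (complexEmbedding 𝕜)).eval y) ≠ 0 := by
    obtain ⟨x, hx⟩ := hne
    exact ⟨toC x, fun h0 => by simpa [h0] using hNP x hx⟩
  rcases CKY.eq_or_eq_neg_or_obstruction_eq_zero
    (CKY.normSq₃_eval_eq_of_eqOn_toC hU hne heq) h0 with h1 | h1 | h1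
  · refine Or.inl (hΓ.generatesForm ha hc hU fun x hx => ?_)
    rw [h1, hE, sdForm_complexEmbedding, hκ x hx]
    ext i j
    simp
  · refine Or.inr (hΓ.generatesForm ha hc hU fun x hx => ?_)
    rw [h1, hE, sdForm_neg, sdForm_complexEmbedding, hκ x hx]
    ext i j
    simp
  · refine absurd (P.isFlatOn_of_obstruction_eq_zero hU h.smooth hN fun x _ i j => ?_) hflat
    apply complexEmbedding_injective
    rw [CKY.map_obstruction, map_zero]
    exact h1 _ i j

end Quadrics

end TwistorQuadric

end

theorem proposition3 {𝕜 : Type*} [RCLike 𝕜] (U : Set (TwistorQuadric.Pt 𝕜))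
    (hU : IsOpen U) (hUc : IsPreconnected U) (Ω : TwistorQuadric.Pt 𝕜 → 𝕜) :
    -- every conformally flat Kähler structure arises from a twistor quadric, and its conformal
    -- factor is given by the quartic formula in the components of the quadric
    (∀ κ, TwistorQuadric.IsConformallyFlatKahler U Ω κ →
      ∃ a b c : Matrix (Fin 2) (Fin 2) ℂ, a.IsSymm ∧ c.IsSymm ∧
        TwistorQuadric.IsTwistorQuadric (TwistorQuadric.quadricOf a b c) ∧
        (∃ Γ, TwistorQuadric.GeneratesFactor (TwistorQuadric.quadricOf a b c) U Γ Ω ∧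
          TwistorQuadric.GeneratesForm (TwistorQuadric.quadricOf a b c) U Γ κ) ∧
        ∀ x ∈ U, 2 * (RCLike.map 𝕜 ℂ (Ω x) ^ 2)⁻¹ =
          TwistorQuadric.quartic a b c (TwistorQuadric.toC x)) ∧
    -- if a quadric generates the conformal factor with `h = 0`, then with `h = 1` it generates a
    -- Kähler form of `Ω² η`, and this is the given one, up to sign, if `Ω² η` is not flat
    (∀ κ, TwistorQuadric.IsConformallyFlatKahler U Ω κ →
      ∀ Q Γ, TwistorQuadric.IsTwistorQuadric Q → TwistorQuadric.GeneratesFactor Q U Γ Ω →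
        (∀ κ', (∀ x ∈ U, (κ' x).map (RCLike.map 𝕜 ℂ) =
            TwistorQuadric.quadricForm Q (Γ x) (TwistorQuadric.toC x)) →
          TwistorQuadric.IsConformallyFlatKahler U Ω κ' ∧
            TwistorQuadric.GeneratesForm Q U Γ κ') ∧
        (¬ TwistorQuadric.IsFlatOn (TwistorQuadric.conformalMetric Ω) U →
          TwistorQuadric.GeneratesForm Q U Γ κ ∨
            TwistorQuadric.GeneratesForm Q U Γ (fun x => -κ x))) ∧
    -- the formula gives the general conformal factor: whenever `Ω` satisfies it, `Ω` arises from
    -- the quadric and `Ω² η` is Kähler with the form generated by the same quadric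
    (∀ a b c : Matrix (Fin 2) (Fin 2) ℂ, a.IsSymm → c.IsSymm →
      ContDiffOn 𝕜 ∞ Ω U → (∀ x ∈ U, Ω x ≠ 0) →
      (∀ x ∈ U, 2 * (RCLike.map 𝕜 ℂ (Ω x) ^ 2)⁻¹ =
        TwistorQuadric.quartic a b c (TwistorQuadric.toC x)) →
      ∃ Γ, TwistorQuadric.GeneratesFactor (TwistorQuadric.quadricOf a b c) U Γ Ω ∧
        ∀ κ', (∀ x ∈ U, (κ' x).map (RCLike.map 𝕜 ℂ) =
            TwistorQuadric.quadricForm (TwistorQuadric.quadricOf a b c) (Γ x)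
              (TwistorQuadric.toC x)) →
          TwistorQuadric.IsConformallyFlatKahler U Ω κ') := by
  refine ⟨fun κ hκ => hκ.exists_quadricOf hU hUc, fun κ hκ Q Γ hQ hΓ => ?_,
    fun a b c ha hc hΩ h0 hq => ?_⟩
  · obtain ⟨a, b, c, ha, hc, rfl⟩ := TwistorQuadric.exists_quadricOf_eq hQ.1
    exact ⟨fun κ' hκ' => hΓ.isConformallyFlatKahler ha hc hU hκ.smooth hκ',
      hκ.generatesForm_or_neg hU hUc ha hc hΓ⟩
  -- The quartic is 2|k|², so the formula says Ω²|k|² = 1, the condition for contours to exist.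
  · obtain ⟨Γ, hΓ⟩ := TwistorQuadric.exists_generatesFactor ha hc hU hΩ.continuousOn
      fun x hx => by
        have h1 : TwistorQuadric.complexEmbedding 𝕜 (Ω x) ≠ 0 := by simpa using h0 x hx
        have h2 : 2 * (TwistorQuadric.complexEmbedding 𝕜 (Ω x) ^ 2)⁻¹ =
            TwistorQuadric.quartic a b c (TwistorQuadric.toC x) := hq x hx
        rw [TwistorQuadric.quartic_eq ha hc] at h2
        rw [← mul_left_cancel₀ two_ne_zero h2, mul_inv_cancel₀ (pow_ne_zero 2 h1)]
    exact ⟨Γ, hΓ, fun κ' hκ' => (hΓ.isConformallyFlatKahler ha hc hU hΩ hκ').1⟩
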